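/- Let $n\ge 2$ and $0\le s\le n+1$, and let $\mathbb{E}^{n+1}_s$ be $\mathbb{R}^{n+1}$ with the flat metric $\tilde g=-dx_1^2-\cdots-dx_s^2+dx_{s+1}^2+\cdots+dx_{n+1}^2$. Let $M$ be a connected smooth $n$-manifold (Hausdorff, second countable) immersed in $\mathbb{E}^{n+1}_s$ as a pseudo-Riemannian hypersurface, i.e. the induced metric $g$ is nondegenerate. Let $V$ be the position vector field along $M$ and $V^T$ its tangential part. Suppose that $(M,g,V^T,\varphi)$ is a Yamabe soliton: $V^T$ is complete, $\varphi$ is a smooth function with $$\varphi\, g=\tfrac12\,\mathcal{L}_{V^T}g ,$$ and $\varphi=R-\rho$, where $R$ is the scalar curvature of $(M,g)$ and $\rho$ is a real constant. Then (the image of) $M$ is contained in one of the following: 1. a hyperplane of $\mathbb{R}^{n+1}$ (an affine subspace of dimension $n$); 2. a conic hypersurface with vertex at the origin, that is, the image of a connected immersed hypersurface $G\colon C\to\mathbb{R}^{n+1}$ (with $C$ Hausdorff and second countable) that is ruled by rays issuing from the origin: for every $q\in C$ there is a continuous curve $\gamma\colon(0,\infty)\to C$ with $\gamma(1)=q$ and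 $G(\gamma(t))=t\,G(q)$ for all $t>0$; 3. a pseudo-hyperbolic space $\mathbb{H}^n_{s-1}(-c^2)=\{\mathbf x : \tilde g(\mathbf x,\mathbf x)=-c^{-2}\}$ for some $c>0$; 4. a pseudo-sphere $\mathbb{S}^n_s(c^2)=\{\mathbf x : \tilde g(\mathbf x,\mathbf x)=c^{-2}\}$ for some $c>0$. -/

import Mathlib

open Set
open scoped Manifold ContDiff

universe u

/-- The coordinate space `ℝⁿ⁺¹` underlying the pseudo-Euclidean space `𝔼ⁿ⁺¹_s`
(only its vector space and smooth structure are used, not its Euclidean norm). -/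
abbrev AmbientSpace (n : ℕ) : Type := EuclideanSpace ℝ (Fin (n + 1))

/-- The flat metric `-dx₁² - ⋯ - dx_s² + dx_{s+1}² + ⋯ + dx_{n+1}²` of `𝔼ⁿ⁺¹_s`. -/
noncomputable def pseudoForm (n s : ℕ) : LinearMap.BilinForm ℝ (AmbientSpace n) :=
  LinearMap.mk₂ ℝ
    (fun x y => ∑ i : Fin (n + 1), (if (i : ℕ) < s then (-1 : ℝ) else 1) * (x i * y i))
    (fun x x' y => by
      rw [← Finset.sum_add_distrib]
      exact Finset.sum_congr rfl fun i _ => by simp only [PiLp.add_apply]; ring)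
    (fun a x y => by
      rw [smul_eq_mul, Finset.mul_sum]
      exact Finset.sum_congr rfl fun i _ => by
        simp only [PiLp.smul_apply, smul_eq_mul]; ring)
    (fun x y y' => by
      rw [← Finset.sum_add_distrib]
      exact Finset.sum_congr rfl fun i _ => by simp only [PiLp.add_apply]; ring)
    (fun a x y => by
      rw [smul_eq_mul, Finset.mul_sum]
      exact Finset.sum_congr rfl fun i _ => by
        simp only [PiLp.smul_apply, smul_eq_mul]; ring)

/-! ### Local coordinate expressions of curvature

A pseudo-Riemannian metric in a coordinate domain of `ℝⁿ` is given by its matrix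
`(g_ij(x))`. -/

section Coordinates

variable {n : ℕ}

/-- The partial derivative `∂ᵢ f`. -/
noncomputable def partialDeriv (i : Fin n) (f : EuclideanSpace ℝ (Fin n) → ℝ)
    (x : EuclideanSpace ℝ (Fin n)) : ℝ :=
  fderiv ℝ f x (EuclideanSpace.single i 1)

/-- Christoffel symbols
`Γᵏ_ij = ½ ∑ₗ gᵏˡ (∂ᵢ g_jl + ∂ⱼ g_il - ∂ₗ g_ij)` of the Levi-Civita connection. -/
noncomputable def christoffel (g : EuclideanSpace ℝ (Fin n) → Matrix (Fin n) (Fin n) ℝ)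
    (k i j : Fin n) (x : EuclideanSpace ℝ (Fin n)) : ℝ :=
  (1 / 2) * ∑ l, (g x)⁻¹ k l *
    (partialDeriv i (fun y => g y j l) x + partialDeriv j (fun y => g y i l) x
      - partialDeriv l (fun y => g y i j) x)

/-- Components of the curvature tensor, `Rm(∂ᵢ, ∂ⱼ) ∂ₖ = ∑ₗ Rˡ_kij ∂ₗ`, where
`Rm(X,Y)Z = ∇_X ∇_Y Z - ∇_Y ∇_X Z - ∇_[X,Y] Z`. -/
noncomputable def riemannTensor (g : EuclideanSpace ℝ (Fin n) → Matrix (Fin n) (Fin n) ℝ)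
    (l k i j : Fin n) (x : EuclideanSpace ℝ (Fin n)) : ℝ :=
  partialDeriv i (christoffel g l j k) x - partialDeriv j (christoffel g l i k) x
    + ∑ m, (christoffel g l i m x * christoffel g m j k x
        - christoffel g l j m x * christoffel g m i k x)

/-- The Ricci tensor `Ric_jk = ∑ᵢ Rⁱ_kij`. -/
noncomputable def ricciTensor (g : EuclideanSpace ℝ (Fin n) → Matrix (Fin n) (Fin n) ℝ)
    (j k : Fin n) (x : EuclideanSpace ℝ (Fin n)) : ℝ :=
  ∑ i, riemannTensor g i k i j x

/-- The scalar curvature `R = ∑ gʲᵏ Ric_jk`. -/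
noncomputable def coordScalarCurvature
    (g : EuclideanSpace ℝ (Fin n) → Matrix (Fin n) (Fin n) ℝ)
    (x : EuclideanSpace ℝ (Fin n)) : ℝ :=
  ∑ j, ∑ k, (g x)⁻¹ j k * ricciTensor g j k x

/-- The component `(L_v g)(∂ᵢ, ∂ⱼ) = v(g_ij) - g([v, ∂ᵢ], ∂ⱼ) - g(∂ᵢ, [v, ∂ⱼ])` of the Lie
derivative of the metric `g` along the vector field `v`. -/
noncomputable def coordLieDerivative
    (g : EuclideanSpace ℝ (Fin n) → Matrix (Fin n) (Fin n) ℝ)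
    (v : EuclideanSpace ℝ (Fin n) → EuclideanSpace ℝ (Fin n))
    (i j : Fin n) (x : EuclideanSpace ℝ (Fin n)) : ℝ :=
  fderiv ℝ (fun y => g y i j) x (v x)
    - ∑ k, (VectorField.lieBracket ℝ v (fun _ => EuclideanSpace.single i 1) x) k * g x k j
    - ∑ k, g x i k * (VectorField.lieBracket ℝ v (fun _ => EuclideanSpace.single j 1) x) k

end Coordinates

/-- A pseudo-Riemannian hypersurface of `𝔼ⁿ⁺¹_s`: a smooth `n`-manifold `M` with a smooth map
into `𝔼ⁿ⁺¹_s` for which the induced symmetric form is nondegenerate on every tangent space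
(in particular the map is an immersion). -/
structure PseudoRiemannianHypersurface (n s : ℕ) (M : Type*) [TopologicalSpace M]
    [ChartedSpace (EuclideanSpace ℝ (Fin n)) M] where
  /-- The immersion, which is also the position vector field along `M`. -/
  position : M → AmbientSpace n
  contMDiff_position : ContMDiff (𝓡 n) 𝓘(ℝ, AmbientSpace n) ∞ position
  nondegenerate : ∀ (p : M) (u : TangentSpace (𝓡 n) p),
    (∀ w : TangentSpace (𝓡 n) p,
      pseudoForm n s (mfderiv (𝓡 n) 𝓘(ℝ, AmbientSpace n) position p u)
        (mfderiv (𝓡 n) 𝓘(ℝ, AmbientSpace n) position p w) = 0) → u = 0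

namespace PseudoRiemannianHypersurface

variable {n s : ℕ} {M : Type*} [TopologicalSpace M] [ChartedSpace (EuclideanSpace ℝ (Fin n)) M]

/-- The differential of the immersion at `p`. -/
noncomputable def differential (F : PseudoRiemannianHypersurface n s M) (p : M) :
    TangentSpace (𝓡 n) p →ₗ[ℝ] AmbientSpace n :=
  (mfderiv (𝓡 n) 𝓘(ℝ, AmbientSpace n) F.position p).toLinearMap

/-- The induced metric `g` on `M`. -/
noncomputable def inducedMetric (F : PseudoRiemannianHypersurface n s M) (p : M) :
    LinearMap.BilinForm ℝ (TangentSpace (𝓡 n) p) :=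
  (pseudoForm n s).comp (F.differential p) (F.differential p)

theorem pseudoForm_comm (x y : AmbientSpace n) : pseudoForm n s x y = pseudoForm n s y x := by
  simp only [pseudoForm, LinearMap.mk₂_apply, mul_comm (x _)]

theorem inducedMetric_nondegenerate (F : PseudoRiemannianHypersurface n s M) (p : M) :
    (F.inducedMetric p).Nondegenerate :=
  ⟨fun u hu => F.nondegenerate p u fun w => hu w,
    fun u hu => F.nondegenerate p u fun w => (pseudoForm_comm _ _).trans (hu w)⟩

instance (p : M) : FiniteDimensional ℝ (TangentSpace (𝓡 n) p) :=
  inferInstanceAs (FiniteDimensional ℝ (EuclideanSpace ℝ (Fin n)))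

/-- The tangential part `Vᵀ` of the position vector field `V`: the tangent vector at `p` with
`g(Vᵀ, w) = g̃(V, w)` for all `w` tangent to `M` at `p`. -/
noncomputable def tangentialPosition (F : PseudoRiemannianHypersurface n s M) (p : M) :
    TangentSpace (𝓡 n) p :=
  ((F.inducedMetric p).toDual (F.inducedMetric_nondegenerate p)).symm
    ((pseudoForm n s (F.position p)).comp (F.differential p))

/-- `V - Vᵀ` is normal to `M`. -/
theorem normal_position_sub_tangentialPosition (F : PseudoRiemannianHypersurface n s M) (p : M)
    (w : TangentSpace (𝓡 n) p) :
    pseudoForm n s (F.position p - F.differential p (F.tangentialPosition p))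
      (F.differential p w) = 0 := by
  have h : F.inducedMetric p (F.tangentialPosition p) w =
      pseudoForm n s (F.position p) (F.differential p w) :=
    LinearMap.BilinForm.apply_toDual_symm_apply _ w
  rw [map_sub, LinearMap.sub_apply, ← h]
  exact sub_self _

/-- The immersion read in the preferred chart around `p`. -/
noncomputable def localRep (F : PseudoRiemannianHypersurface n s M) (p : M) :
    EuclideanSpace ℝ (Fin n) → AmbientSpace n :=
  F.position ∘ (extChartAt (𝓡 n) p).symm

/-- The matrix `g_ij = g̃(∂ᵢ F, ∂ⱼ F)` of the induced metric in the preferred chart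
around `p`. -/
noncomputable def coordMetric (F : PseudoRiemannianHypersurface n s M) (p : M)
    (x : EuclideanSpace ℝ (Fin n)) : Matrix (Fin n) (Fin n) ℝ :=
  Matrix.of fun i j => pseudoForm n s
    (fderiv ℝ (F.localRep p) x (EuclideanSpace.single i 1))
    (fderiv ℝ (F.localRep p) x (EuclideanSpace.single j 1))

/-- A vector field on `M` read in the preferred chart around `p`. -/
noncomputable def coordVectorField (v : (q : M) → TangentSpace (𝓡 n) q) (p : M)
    (x : EuclideanSpace ℝ (Fin n)) : EuclideanSpace ℝ (Fin n) :=
  mfderiv (𝓡 n) 𝓘(ℝ, EuclideanSpace ℝ (Fin n)) (extChartAt (𝓡 n) p)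
    ((extChartAt (𝓡 n) p).symm x) (v ((extChartAt (𝓡 n) p).symm x))

/-- The scalar curvature `R` of `(M, g)`, computed at `p` in the preferred chart around `p`. -/
noncomputable def scalarCurvature (F : PseudoRiemannianHypersurface n s M) (p : M) : ℝ :=
  coordScalarCurvature (F.coordMetric p) (extChartAt (𝓡 n) p p)

/-- A vector field is complete if through every point there is an integral curve defined on
all of `ℝ`. -/
def IsCompleteVectorField (v : (q : M) → TangentSpace (𝓡 n) q) : Prop :=
  ∀ p : M, ∃ γ : ℝ → M, γ 0 = p ∧ IsMIntegralCurve γ v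

/-- `(M, g, v, φ)` is a conformal soliton: `v` is a smooth complete vector field, `φ` is a
smooth function and `φ g = ½ L_v g`. The last identity is between tensors, so at each point `p`
it is expressed by its components in the preferred chart around `p`. -/
structure IsConformalSoliton [IsManifold (𝓡 n) ∞ M] (F : PseudoRiemannianHypersurface n s M)
    (v : (q : M) → TangentSpace (𝓡 n) q) (φ : M → ℝ) : Prop where
  smooth_vectorField :
    ContMDiff (𝓡 n) (𝓡 n).tangent ∞ (fun q => (⟨q, v q⟩ : TangentBundle (𝓡 n) M))
  complete : IsCompleteVectorField v
  smooth_function : ContMDiff (𝓡 n) 𝓘(ℝ, ℝ) ∞ φ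
  equation : ∀ (p : M) (i j : Fin n),
    φ p * F.coordMetric p (extChartAt (𝓡 n) p p) i j =
      (1 / 2) * coordLieDerivative (F.coordMetric p) (coordVectorField v p) i j
        (extChartAt (𝓡 n) p p)

/-- `(M, g, v, φ)` is a Yamabe soliton: a conformal soliton with `φ = R - ρ`, where `R` is the
scalar curvature and `ρ` is a real constant; that is, `(R - ρ) g = ½ L_v g`. -/
def IsYamabeSoliton [IsManifold (𝓡 n) ∞ M] (F : PseudoRiemannianHypersurface n s M)
    (v : (q : M) → TangentSpace (𝓡 n) q) (φ : M → ℝ) : Prop :=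
  F.IsConformalSoliton v φ ∧ ∃ ρ : ℝ, ∀ p, φ p = F.scalarCurvature p - ρ

end PseudoRiemannianHypersurface

/-- A hyperplane (not necessarily through the origin) of `ℝⁿ⁺¹`. -/
def IsHyperplane (n : ℕ) (S : Set (AmbientSpace n)) : Prop :=
  ∃ P : AffineSubspace ℝ (AmbientSpace n), (P : Set (AmbientSpace n)).Nonempty ∧
    Module.finrank ℝ P.direction = n ∧ S = P

/-- A conic hypersurface with vertex at the origin: an immersed connected hypersurface
`G : C → ℝⁿ⁺¹` ruled by open rays issuing from the origin, i.e. through every point `q` of `C`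
there is a continuous curve in `C` that `G` carries to the whole ray `t ↦ t • G q`, `t > 0`. -/
def IsConicHypersurface (n : ℕ) (S : Set (AmbientSpace n)) : Prop :=
  ∃ (C : Type u) (_ : TopologicalSpace C) (_ : ChartedSpace (EuclideanSpace ℝ (Fin n)) C)
    (G : C → AmbientSpace n),
    T2Space C ∧ SecondCountableTopology C ∧ ConnectedSpace C ∧ IsManifold (𝓡 n) ∞ C ∧
    ContMDiff (𝓡 n) 𝓘(ℝ, AmbientSpace n) ∞ G ∧
    (∀ q, Function.Injective (mfderiv (𝓡 n) 𝓘(ℝ, AmbientSpace n) G q)) ∧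
    (∀ q, ∃ γ : ℝ → C, ContinuousOn γ (Ioi 0) ∧ γ 1 = q ∧ ∀ t > 0, G (γ t) = t • G q) ∧
    S = range G

/-- The pseudo-sphere `𝕊ⁿ_s(c²)`. -/
def pseudoSphere (n s : ℕ) (c : ℝ) : Set (AmbientSpace n) :=
  {x | pseudoForm n s x x = (c ^ 2)⁻¹}

/-- The pseudo-hyperbolic space `ℍⁿ_{s-1}(-c²)`. -/
def pseudoHyperbolicSpace (n s : ℕ) (c : ℝ) : Set (AmbientSpace n) :=
  {x | pseudoForm n s x x = -(c ^ 2)⁻¹}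

/-! Split the position vector as `V = Vᵀ + ξ` with `ξ` normal, and put `f = ⟨ξ, ξ⟩`, `μ = φ - 1`.
Since `dV` is the inclusion of the tangent space, the Lie derivative of `g` along `Vᵀ` is `2(g -
⟨dξ, dV⟩)` (`coordLieDerivative_tangential`), so the soliton equation reads `⟨dξ, dV⟩ = -μ g`: the
hypersurface is umbilical wherever `f ≠ 0`. There the Gauss equation gives `R f = n(n-1) μ²`
(`coordScalarCurvature_of_normal`), and the Yamabe condition turns this into an algebraic relation
between `μ` and `f`.

The core is `rigidity_of_yamabe`. Where `f ≠ 0`, write `∂ₖξ = cₖ ξ - μ ∂ₖV`. Equality of mixed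
derivatives of `ξ` (Codazzi) yields `∂ₖμ = cₖ μ`, because `n ≥ 2`. Also `∂ₖf = 2 cₖ f`.
Differentiating the Yamabe relation then gives `cₖ μ = 0`, while differentiating `f = ⟨ξ, V⟩` gives
`cₖ f = -μ ⟨V, ∂ₖV⟩`. Together they force `cₖ = 0`, so `dξ = -μ dV`, `dμ = 0`, and either `μ = 0` or
`V` is normal.

Hence a nonzero value of `f` is taken on an open and closed set (`normalPosition_self_const`), so
`f` is either identically zero or a nonzero constant. If `f = 0`, nondegeneracy of `g` makes `ξ =
0`; the integral curves of `Vᵀ = V` are `eᵗ V`, and completeness supplies whole rays. If `f ≠ 0` and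
`φ = 1`, then `ξ` is constant and `⟨ξ, V⟩` is constant: a hyperplane. If `f ≠ 0` and `φ ≠ 1`, then
`V = ξ` and `⟨V, V⟩ = f`, whose sign selects the last two cases. -/

/-! ### The pseudo-Euclidean form -/

/-- The flat metric as a continuous bilinear form. -/
noncomputable def pseudoFormL (n s : ℕ) : AmbientSpace n →L[ℝ] AmbientSpace n →L[ℝ] ℝ :=
  (pseudoForm n s).toContinuousBilinearMap

theorem pseudoFormL_apply (n s : ℕ) (x y : AmbientSpace n) :
    pseudoFormL n s x y = pseudoForm n s x y := rfl

theorem pseudoFormL_comm (n s : ℕ) (x y : AmbientSpace n) :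
    pseudoFormL n s x y = pseudoFormL n s y x :=
  PseudoRiemannianHypersurface.pseudoForm_comm x y

theorem eq_zero_of_pseudoFormL_eq_zero {n s : ℕ} {x : AmbientSpace n}
    (h : ∀ y, pseudoFormL n s x y = 0) : x = 0 := by
  ext i
  have hi := h (EuclideanSpace.single i 1)
  rw [pseudoFormL_apply, pseudoForm, LinearMap.mk₂_apply, Finset.sum_eq_single i] at hi
  · split_ifs at hi <;> simpa using hi
  · intro j _ hj
    simp [hj]
  · simp

/-! ### Normal vectors of a hyperplane -/

section NormalLine

variable {n : ℕ} {s : ℕ} {L : EuclideanSpace ℝ (Fin n) →L[ℝ] AmbientSpace n}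
  {ξ : AmbientSpace n}

/-- Dimension count: `(x, t) ↦ L x + t ξ` is injective between spaces of dimension `n + 1`. Only
transversality of `ξ` matters, not normality. -/
theorem exists_eq_add_smul_normal (hL : Function.Injective L) (hξ : ∀ x, L x ≠ ξ)
    (w : AmbientSpace n) : ∃ x, ∃ t : ℝ, w = L x + t • ξ := by
  let T : EuclideanSpace ℝ (Fin n) × ℝ →ₗ[ℝ] AmbientSpace n :=
    L.toLinearMap.coprod (LinearMap.toSpanSingleton ℝ _ ξ)
  have hT : Function.Injective T := by
    rw [injective_iff_map_eq_zero]
    rintro ⟨x, t⟩ h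
    have h' : L x + t • ξ = 0 := h
    have ht : t = 0 := by
      by_contra ht
      refine hξ (-(t⁻¹ • x)) ?_
      rw [map_neg, map_smul, eq_neg_of_add_eq_zero_left h', smul_neg, neg_neg, smul_smul,
        inv_mul_cancel₀ ht, one_smul]
    subst ht
    have hx : x = 0 := hL (by simpa using h')
    rw [hx]; rfl
  obtain ⟨⟨x, t⟩, h⟩ := (LinearMap.injective_iff_surjective_of_finrank_eq_finrank
    (by simp)).1 hT w
  exact ⟨x, t, h.symm⟩

/-- A normal vector is a multiple of a given non-null normal vector. -/
theorem normal_eq_smul (hL : Function.Injective L) (hξL : ∀ x, pseudoFormL n s ξ (L x) = 0)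
    (hξ : pseudoFormL n s ξ ξ ≠ 0) {w : AmbientSpace n}
    (hw : ∀ x, pseudoFormL n s w (L x) = 0) :
    w = (pseudoFormL n s w ξ / pseudoFormL n s ξ ξ) • ξ := by
  rw [← sub_eq_zero]
  refine eq_zero_of_pseudoFormL_eq_zero (s := s) fun y => ?_
  obtain ⟨x, t, rfl⟩ := exists_eq_add_smul_normal (ξ := ξ) hL
    (fun x hx => hξ (by nth_rw 2 [← hx]; exact hξL x)) y
  simp only [map_sub, map_smul, map_add, sub_apply,
    smul_apply, hw, hξL, smul_eq_mul]
  field_simp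
  ring

/-- A nondegenerate hyperplane has no null normal vectors. -/
theorem normal_eq_zero_of_null (hL : Function.Injective L)
    (hnd : ∀ x, (∀ y, pseudoFormL n s (L x) (L y) = 0) → x = 0)
    (hξL : ∀ x, pseudoFormL n s ξ (L x) = 0) (hξ : pseudoFormL n s ξ ξ = 0) : ξ = 0 := by
  by_cases h : ∃ x, L x = ξ
  · obtain ⟨x, rfl⟩ := h
    rw [hnd x hξL, map_zero]
  · refine eq_zero_of_pseudoFormL_eq_zero (s := s) fun y => ?_
    obtain ⟨x, t, rfl⟩ := exists_eq_add_smul_normal hL (fun x hx => h ⟨x, hx⟩) y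
    simp [hξL, hξ]

end NormalLine

/-! ### Coordinate derivatives of vector-valued maps -/

section CoordDeriv

variable {n : ℕ} {E : Type*} [NormedAddCommGroup E] [NormedSpace ℝ E]

/-- The partial derivative `∂ᵢ h` of a vector-valued map. -/
noncomputable def coordDeriv (i : Fin n) (h : EuclideanSpace ℝ (Fin n) → E)
    (x : EuclideanSpace ℝ (Fin n)) : E :=
  fderiv ℝ h x (EuclideanSpace.single i 1)

theorem fderiv_apply_eq_sum_coordDeriv (h : EuclideanSpace ℝ (Fin n) → E)
    (x v : EuclideanSpace ℝ (Fin n)) : fderiv ℝ h x v = ∑ i, v i • coordDeriv i h x := by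
  conv_lhs => rw [← (EuclideanSpace.basisFun (Fin n) ℝ).sum_repr v]
  simp [coordDeriv]

theorem ContDiffOn.coordDeriv {U : Set (EuclideanSpace ℝ (Fin n))} (hU : IsOpen U)
    {h : EuclideanSpace ℝ (Fin n) → E} (hh : ContDiffOn ℝ ∞ h U) (i : Fin n) :
    ContDiffOn ℝ ∞ (coordDeriv i h) U :=
  (hh.fderiv_of_isOpen hU le_rfl).clm_apply contDiffOn_const

theorem ContDiffOn.differentiableAt_of_mem {U : Set (EuclideanSpace ℝ (Fin n))} (hU : IsOpen U)
    {h : EuclideanSpace ℝ (Fin n) → E} (hh : ContDiffOn ℝ ∞ h U)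
    {x : EuclideanSpace ℝ (Fin n)} (hx : x ∈ U) : DifferentiableAt ℝ h x :=
  (hh.contDiffAt (hU.mem_nhds hx)).differentiableAt (by simp)

theorem coordDeriv_comm {U : Set (EuclideanSpace ℝ (Fin n))} (hU : IsOpen U)
    {h : EuclideanSpace ℝ (Fin n) → E} (hh : ContDiffOn ℝ ∞ h U)
    {x : EuclideanSpace ℝ (Fin n)} (hx : x ∈ U) (i j : Fin n) :
    coordDeriv i (coordDeriv j h) x = coordDeriv j (coordDeriv i h) x := by
  have hd : DifferentiableAt ℝ (fderiv ℝ h) x :=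
    (hh.fderiv_of_isOpen hU (m := ∞) le_rfl).differentiableAt_of_mem hU hx
  have key : ∀ k l, coordDeriv k (coordDeriv l h) x =
      fderiv ℝ (fderiv ℝ h) x (EuclideanSpace.single k 1) (EuclideanSpace.single l 1) := by
    intro k l
    simp only [coordDeriv]
    change fderiv ℝ (fun y => fderiv ℝ h y (EuclideanSpace.single l 1)) x _ = _
    rw [fderiv_clm_apply hd (by fun_prop)]
    simp
  rw [key, key]
  exact ((hh.contDiffAt (hU.mem_nhds hx)).isSymmSndFDerivAt
    (by rw [minSmoothness_of_isRCLikeNormedField]; exact ENat.LEInfty.out)).eq _ _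

theorem partialDeriv_bilin (B : E →L[ℝ] E →L[ℝ] ℝ) {a b : EuclideanSpace ℝ (Fin n) → E}
    {x : EuclideanSpace ℝ (Fin n)} (ha : DifferentiableAt ℝ a x) (hb : DifferentiableAt ℝ b x)
    (i : Fin n) :
    partialDeriv i (fun y => B (a y) (b y)) x =
      B (a x) (coordDeriv i b x) + B (coordDeriv i a x) (b x) := by
  simp [partialDeriv, coordDeriv, B.fderiv_of_bilinear ha hb]

theorem coordDeriv_congr {a b : EuclideanSpace ℝ (Fin n) → E}
    {U : Set (EuclideanSpace ℝ (Fin n))} (hU : IsOpen U) (h : EqOn a b U)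
    {x : EuclideanSpace ℝ (Fin n)} (hx : x ∈ U) (i : Fin n) :
    coordDeriv i a x = coordDeriv i b x := by
  rw [coordDeriv, (h.eventuallyEq_of_mem (hU.mem_nhds hx)).fderiv_eq, coordDeriv]

theorem partialDeriv_congr {a b : EuclideanSpace ℝ (Fin n) → ℝ}
    {U : Set (EuclideanSpace ℝ (Fin n))} (hU : IsOpen U) (h : EqOn a b U)
    {x : EuclideanSpace ℝ (Fin n)} (hx : x ∈ U) (i : Fin n) :
    partialDeriv i a x = partialDeriv i b x :=
  coordDeriv_congr hU h hx i

theorem partialDeriv_mul {a b : EuclideanSpace ℝ (Fin n) → ℝ}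
    {x : EuclideanSpace ℝ (Fin n)} (ha : DifferentiableAt ℝ a x) (hb : DifferentiableAt ℝ b x)
    (i : Fin n) :
    partialDeriv i (fun y => a y * b y) x = a x * partialDeriv i b x + partialDeriv i a x * b x := by
  simp only [partialDeriv]
  rw [fderiv_fun_mul ha hb]
  simp [mul_comm]

theorem partialDeriv_sum {ι : Type*} (t : Finset ι) {a : ι → EuclideanSpace ℝ (Fin n) → ℝ}
    {x : EuclideanSpace ℝ (Fin n)} (ha : ∀ k ∈ t, DifferentiableAt ℝ (a k) x) (i : Fin n) :
    partialDeriv i (fun y => ∑ k ∈ t, a k y) x = ∑ k ∈ t, partialDeriv i (a k) x := by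
  simp only [partialDeriv]
  rw [fderiv_fun_sum ha]
  simp

end CoordDeriv

/-! ### Smoothness of the inverse matrix -/

section MatrixInverse

variable {X : Type*} [NormedAddCommGroup X] [NormedSpace ℝ X] {ι : Type*} [Fintype ι]
  [DecidableEq ι]

theorem ContDiffAt.matrix_det {A : X → Matrix ι ι ℝ} {x : X}
    (hA : ∀ i j, ContDiffAt ℝ ∞ (fun y => A y i j) x) :
    ContDiffAt ℝ ∞ (fun y => (A y).det) x := by
  simp only [Matrix.det_apply']
  exact ContDiffAt.sum fun σ _ => contDiffAt_const.mul (contDiffAt_prod fun i _ => hA _ _)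

/-- Cramer's rule makes each entry of the inverse a polynomial in the entries of `A` divided by the
determinant, so no norm on matrices is needed. -/
theorem ContDiffAt.matrix_inv {A : X → Matrix ι ι ℝ} {x : X}
    (hA : ∀ i j, ContDiffAt ℝ ∞ (fun y => A y i j) x) (hx : (A x).det ≠ 0) (i j : ι) :
    ContDiffAt ℝ ∞ (fun y => (A y)⁻¹ i j) x := by
  have h : (fun y => (A y)⁻¹ i j) =
      fun y => ((A y).det)⁻¹ * ((A y).updateRow j (Pi.single i 1)).det := by
    funext y
    rw [Matrix.inv_def, Matrix.smul_apply, Matrix.adjugate_apply, Ring.inverse_eq_inv',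
      smul_eq_mul]
  rw [h]
  refine (ContDiffAt.inv (ContDiffAt.matrix_det hA) hx).mul (ContDiffAt.matrix_det fun k l => ?_)
  by_cases hk : k = j
  · subst hk
    simpa using contDiffAt_const
  · simpa [Matrix.updateRow_ne hk] using hA k l

end MatrixInverse

/-! ### The Gauss equation and the Lie derivative for immersions of coordinate domains -/

section Gauss

variable {n : ℕ} {E : Type*} [NormedAddCommGroup E] [NormedSpace ℝ E]

/-- The matrix of the symmetric form induced by a map of a coordinate domain. -/
noncomputable def gramMatrix (B : E →L[ℝ] E →L[ℝ] ℝ) (Φ : EuclideanSpace ℝ (Fin n) → E)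
    (x : EuclideanSpace ℝ (Fin n)) : Matrix (Fin n) (Fin n) ℝ :=
  Matrix.of fun i j => B (coordDeriv i Φ x) (coordDeriv j Φ x)

theorem gramMatrix_apply (B : E →L[ℝ] E →L[ℝ] ℝ) (Φ : EuclideanSpace ℝ (Fin n) → E)
    (x : EuclideanSpace ℝ (Fin n)) (i j : Fin n) :
    gramMatrix B Φ x i j = B (coordDeriv i Φ x) (coordDeriv j Φ x) := rfl

variable {B : E →L[ℝ] E →L[ℝ] ℝ} {Φ : EuclideanSpace ℝ (Fin n) → E}
  {U : Set (EuclideanSpace ℝ (Fin n))} {x : EuclideanSpace ℝ (Fin n)}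

theorem gramMatrix_symm (hB : ∀ a b, B a b = B b a) (i j : Fin n) :
    gramMatrix B Φ x i j = gramMatrix B Φ x j i := hB _ _

theorem partialDeriv_gramMatrix (hU : IsOpen U) (hΦ : ContDiffOn ℝ ∞ Φ U) (hx : x ∈ U)
    (i j k : Fin n) :
    partialDeriv i (fun y => gramMatrix B Φ y j k) x =
      B (coordDeriv j Φ x) (coordDeriv i (coordDeriv k Φ) x) +
        B (coordDeriv i (coordDeriv j Φ) x) (coordDeriv k Φ x) :=
  partialDeriv_bilin B ((hΦ.coordDeriv hU j).differentiableAt_of_mem hU hx)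
    ((hΦ.coordDeriv hU k).differentiableAt_of_mem hU hx) i

theorem contDiffAt_gramMatrix (hU : IsOpen U) (hΦ : ContDiffOn ℝ ∞ Φ U) (hx : x ∈ U)
    (i j : Fin n) : ContDiffAt ℝ ∞ (fun y => gramMatrix B Φ y i j) x :=
  (B.isBoundedBilinearMap.contDiff.comp_contDiffAt x <|
    ((hΦ.coordDeriv hU i).contDiffAt (hU.mem_nhds hx)).prodMk
      ((hΦ.coordDeriv hU j).contDiffAt (hU.mem_nhds hx)) :)

/-- The Christoffel symbols of the induced metric: `Γᵏ_ij = gᵏˡ ⟨∂ₗΦ, ∂ᵢ∂ⱼΦ⟩`. -/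
theorem christoffel_gramMatrix (hB : ∀ a b, B a b = B b a) (hU : IsOpen U)
    (hΦ : ContDiffOn ℝ ∞ Φ U) (hx : x ∈ U) (k i j : Fin n) :
    christoffel (gramMatrix B Φ) k i j x =
      ∑ l, (gramMatrix B Φ x)⁻¹ k l *
        B (coordDeriv l Φ x) (coordDeriv i (coordDeriv j Φ) x) := by
  rw [christoffel, Finset.mul_sum]
  refine Finset.sum_congr rfl fun l _ => ?_
  simp only [partialDeriv_gramMatrix hU hΦ hx]
  rw [coordDeriv_comm hU hΦ hx j i, coordDeriv_comm hU hΦ hx l i, coordDeriv_comm hU hΦ hx l j,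
    hB (coordDeriv i (coordDeriv l Φ) x), hB (coordDeriv i (coordDeriv j Φ) x) (coordDeriv l Φ x)]
  ring

/-- The index of the Christoffel symbol is lowered so that the identity can be differentiated
without differentiating `g⁻¹`. -/
theorem gramMatrix_mul_christoffel (hB : ∀ a b, B a b = B b a) (hU : IsOpen U)
    (hΦ : ContDiffOn ℝ ∞ Φ U) (hdet : ∀ y ∈ U, (gramMatrix B Φ y).det ≠ 0) (hx : x ∈ U)
    (l i j : Fin n) :
    ∑ m, gramMatrix B Φ x l m * christoffel (gramMatrix B Φ) m i j x =
      B (coordDeriv l Φ x) (coordDeriv i (coordDeriv j Φ) x) := by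
  have hinv := Matrix.mul_nonsing_inv (gramMatrix B Φ x) (hdet x hx).isUnit
  have h := congrFun (Matrix.mulVec_mulVec
    (fun r => B (coordDeriv r Φ x) (coordDeriv i (coordDeriv j Φ) x))
    (gramMatrix B Φ x) (gramMatrix B Φ x)⁻¹) l
  rw [hinv, Matrix.one_mulVec] at h
  rw [← h]
  simp only [christoffel_gramMatrix hB hU hΦ hx]
  rfl

theorem contDiffAt_christoffel (hB : ∀ a b, B a b = B b a) (hU : IsOpen U)
    (hΦ : ContDiffOn ℝ ∞ Φ U) (hdet : ∀ y ∈ U, (gramMatrix B Φ y).det ≠ 0) (hx : x ∈ U)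
    (k i j : Fin n) : ContDiffAt ℝ ∞ (christoffel (gramMatrix B Φ) k i j) x := by
  have h : ContDiffAt ℝ ∞ (fun y => ∑ l, (gramMatrix B Φ y)⁻¹ k l *
      B (coordDeriv l Φ y) (coordDeriv i (coordDeriv j Φ) y)) x := by
    refine ContDiffAt.sum fun l _ => ContDiffAt.mul
      (ContDiffAt.matrix_inv (contDiffAt_gramMatrix hU hΦ hx) (hdet x hx) k l) ?_
    exact B.isBoundedBilinearMap.contDiff.comp_contDiffAt x <|
      ((hΦ.coordDeriv hU l).contDiffAt (hU.mem_nhds hx)).prodMk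
        (((hΦ.coordDeriv hU j).coordDeriv hU i).contDiffAt (hU.mem_nhds hx))
  refine h.congr_of_eventuallyEq ?_
  filter_upwards [hU.mem_nhds hx] with y hy using christoffel_gramMatrix hB hU hΦ hy k i j

/-- The second fundamental form: the normal part of `∂ᵢ∂ⱼΦ`. -/
noncomputable def secondFundamentalForm (B : E →L[ℝ] E →L[ℝ] ℝ)
    (Φ : EuclideanSpace ℝ (Fin n) → E) (i j : Fin n) (x : EuclideanSpace ℝ (Fin n)) : E :=
  coordDeriv i (coordDeriv j Φ) x -
    ∑ m, christoffel (gramMatrix B Φ) m i j x • coordDeriv m Φ x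

theorem secondFundamentalForm_normal (hB : ∀ a b, B a b = B b a) (hU : IsOpen U)
    (hΦ : ContDiffOn ℝ ∞ Φ U) (hdet : ∀ y ∈ U, (gramMatrix B Φ y).det ≠ 0) (hx : x ∈ U)
    (i j l : Fin n) : B (coordDeriv l Φ x) (secondFundamentalForm B Φ i j x) = 0 := by
  rw [secondFundamentalForm, map_sub, map_sum, sub_eq_zero,
    ← gramMatrix_mul_christoffel hB hU hΦ hdet hx]
  exact Finset.sum_congr rfl fun m _ => by
    rw [map_smul, smul_eq_mul, mul_comm, gramMatrix_apply]

theorem bilin_secondFundamentalForm (hB : ∀ a b, B a b = B b a) (hU : IsOpen U)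
    (hΦ : ContDiffOn ℝ ∞ Φ U) (hdet : ∀ y ∈ U, (gramMatrix B Φ y).det ≠ 0) (hx : x ∈ U)
    (i l j k : Fin n) :
    B (secondFundamentalForm B Φ i l x) (secondFundamentalForm B Φ j k x) =
      B (coordDeriv i (coordDeriv l Φ) x) (secondFundamentalForm B Φ j k x) := by
  conv_lhs => rw [secondFundamentalForm]
  simp [secondFundamentalForm_normal hB hU hΦ hdet hx]

/-- The covariant third derivative identity from which the Gauss equation follows by
antisymmetrization. -/
theorem gramMatrix_mul_deriv_christoffel (hB : ∀ a b, B a b = B b a) (hU : IsOpen U)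
    (hΦ : ContDiffOn ℝ ∞ Φ U) (hdet : ∀ y ∈ U, (gramMatrix B Φ y).det ≠ 0) (hx : x ∈ U)
    (p i j k : Fin n) :
    ∑ l, gramMatrix B Φ x p l * (partialDeriv i (christoffel (gramMatrix B Φ) l j k) x +
        ∑ m, christoffel (gramMatrix B Φ) l i m x * christoffel (gramMatrix B Φ) m j k x) =
      B (secondFundamentalForm B Φ i p x) (secondFundamentalForm B Φ j k x) +
        B (coordDeriv p Φ x) (coordDeriv i (coordDeriv j (coordDeriv k Φ)) x) := by
  -- Differentiate the lowered Christoffel identity. In `∂ᵢ g_pl`, the term with `∂ᵢ∂ₚΦ` assembles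
  -- into the second fundamental form (`e1`), and the term with `∂ᵢ∂ₗΦ` cancels the quadratic term
  -- in the Christoffel symbols (`e2`).
  have hd := partialDeriv_congr hU
    (fun y hy => gramMatrix_mul_christoffel hB hU hΦ hdet hy p j k) hx i
  have hG : ∀ l, DifferentiableAt ℝ (fun y => gramMatrix B Φ y p l) x := fun l =>
    (contDiffAt_gramMatrix hU hΦ hx p l).differentiableAt (by simp)
  have hC : ∀ l, DifferentiableAt ℝ (christoffel (gramMatrix B Φ) l j k) x := fun l =>
    (contDiffAt_christoffel hB hU hΦ hdet hx l j k).differentiableAt (by simp)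
  rw [partialDeriv_sum _ (fun l _ => (hG l).fun_mul (hC l)),
    partialDeriv_bilin B ((hΦ.coordDeriv hU p).differentiableAt_of_mem hU hx)
      (((hΦ.coordDeriv hU k).coordDeriv hU j).differentiableAt_of_mem hU hx)] at hd
  simp only [partialDeriv_mul (hG _) (hC _), partialDeriv_gramMatrix hU hΦ hx, add_mul,
    Finset.sum_add_distrib] at hd
  rw [bilin_secondFundamentalForm hB hU hΦ hdet hx]
  have e1 : B (coordDeriv i (coordDeriv p Φ) x) (secondFundamentalForm B Φ j k x) =
      B (coordDeriv i (coordDeriv p Φ) x) (coordDeriv j (coordDeriv k Φ) x) -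
        ∑ m, B (coordDeriv i (coordDeriv p Φ) x) (coordDeriv m Φ x) *
          christoffel (gramMatrix B Φ) m j k x := by
    simp only [secondFundamentalForm, map_sub, map_sum, map_smul, smul_eq_mul, mul_comm]
  have e2 : ∑ l, gramMatrix B Φ x p l *
      ∑ m, christoffel (gramMatrix B Φ) l i m x * christoffel (gramMatrix B Φ) m j k x =
      ∑ m, B (coordDeriv p Φ x) (coordDeriv i (coordDeriv m Φ) x) *
          christoffel (gramMatrix B Φ) m j k x := by
    simp only [Finset.mul_sum, ← gramMatrix_mul_christoffel hB hU hΦ hdet hx, Finset.sum_mul]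
    rw [Finset.sum_comm]
    exact Finset.sum_congr rfl fun _ _ => Finset.sum_congr rfl fun _ _ => by ring
  simp only [mul_add, Finset.sum_add_distrib]
  rw [e1, e2]
  linarith

/-- The Gauss equation. -/
theorem gramMatrix_mul_riemannTensor (hB : ∀ a b, B a b = B b a) (hU : IsOpen U)
    (hΦ : ContDiffOn ℝ ∞ Φ U) (hdet : ∀ y ∈ U, (gramMatrix B Φ y).det ≠ 0) (hx : x ∈ U)
    (p k i j : Fin n) :
    ∑ l, gramMatrix B Φ x p l * riemannTensor (gramMatrix B Φ) l k i j x =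
      B (secondFundamentalForm B Φ i p x) (secondFundamentalForm B Φ j k x) -
        B (secondFundamentalForm B Φ j p x) (secondFundamentalForm B Φ i k x) := by
  have h1 := gramMatrix_mul_deriv_christoffel hB hU hΦ hdet hx p i j k
  have h2 := gramMatrix_mul_deriv_christoffel hB hU hΦ hdet hx p j i k
  rw [coordDeriv_comm hU (hΦ.coordDeriv hU k) hx j i] at h2
  have e : ∑ l, gramMatrix B Φ x p l * riemannTensor (gramMatrix B Φ) l k i j x =
      ∑ l, gramMatrix B Φ x p l * (partialDeriv i (christoffel (gramMatrix B Φ) l j k) x +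
        ∑ m, christoffel (gramMatrix B Φ) l i m x * christoffel (gramMatrix B Φ) m j k x) -
      ∑ l, gramMatrix B Φ x p l * (partialDeriv j (christoffel (gramMatrix B Φ) l i k) x +
        ∑ m, christoffel (gramMatrix B Φ) l j m x * christoffel (gramMatrix B Φ) m i k x) := by
    rw [← Finset.sum_sub_distrib]
    refine Finset.sum_congr rfl fun l _ => ?_
    rw [riemannTensor, Finset.sum_sub_distrib]
    ring
  rw [e, h1, h2]
  ring

/-- The scalar curvature of an umbilical hypersurface. -/
theorem coordScalarCurvature_of_umbilical (hB : ∀ a b, B a b = B b a) (hU : IsOpen U)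
    (hΦ : ContDiffOn ℝ ∞ Φ U) (hdet : ∀ y ∈ U, (gramMatrix B Φ y).det ≠ 0) (hx : x ∈ U)
    (K : ℝ) (hK : ∀ i p j k, B (secondFundamentalForm B Φ i p x)
      (secondFundamentalForm B Φ j k x) = K * gramMatrix B Φ x i p * gramMatrix B Φ x j k) :
    coordScalarCurvature (gramMatrix B Φ) x = K * (n * (n - 1)) := by
  have hdx := (hdet x hx).isUnit
  have hR : ∀ k i j l, riemannTensor (gramMatrix B Φ) l k i j x =
      K * ((if l = i then gramMatrix B Φ x j k else 0) -
        (if l = j then gramMatrix B Φ x i k else 0)) := by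
    intro k i j
    -- The Gauss equation determines the curvature with its index lowered; invertibility of `g` lets
    -- the index be raised again.
    refine congrFun (Matrix.mulVec_injective_of_isUnit
      ((Matrix.isUnit_iff_isUnit_det _).2 hdx) (funext fun p => ?_))
    simp only [Matrix.mulVec, dotProduct]
    rw [gramMatrix_mul_riemannTensor hB hU hΦ hdet hx, hK, hK]
    simp only [mul_sub, Finset.sum_sub_distrib, mul_ite, mul_zero, Finset.sum_ite_eq',
      Finset.mem_univ, if_true]
    rw [gramMatrix_symm hB i p, gramMatrix_symm hB j p]
    ring
  have hRic : ∀ j k, ricciTensor (gramMatrix B Φ) j k x =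
      K * (n - 1) * gramMatrix B Φ x j k := by
    intro j k
    simp only [ricciTensor, hR, ← Finset.mul_sum, Finset.sum_sub_distrib, Finset.sum_ite_eq',
      Finset.mem_univ, if_true, Finset.sum_const, Finset.card_univ, Fintype.card_fin,
      nsmul_eq_mul]
    ring
  have hinv := Matrix.nonsing_inv_mul (gramMatrix B Φ x) hdx
  have ht : ∀ j, ∑ k, (gramMatrix B Φ x)⁻¹ j k * gramMatrix B Φ x j k = 1 := by
    intro j
    have h := congrFun (congrFun hinv j) j
    rw [Matrix.mul_apply, Matrix.one_apply_eq] at h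
    rw [← h]
    exact Finset.sum_congr rfl fun k _ => by rw [gramMatrix_symm hB j k]
  have hS : ∀ j, ∑ k, (gramMatrix B Φ x)⁻¹ j k * (K * (n - 1) * gramMatrix B Φ x j k) =
      K * (n - 1) := by
    intro j
    calc _ = (K * ((n : ℝ) - 1)) * ∑ k, (gramMatrix B Φ x)⁻¹ j k * gramMatrix B Φ x j k := by
          rw [Finset.mul_sum]
          exact Finset.sum_congr rfl fun k _ => by ring
      _ = _ := by rw [ht j, mul_one]
  simp only [coordScalarCurvature, hRic, hS, Finset.sum_const, Finset.card_univ,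
    Fintype.card_fin, nsmul_eq_mul]
  ring

/-- The Lie derivative of the induced metric along the tangential part `v` of `Φ`, in terms of
the normal part `ξ`. -/
theorem coordLieDerivative_tangential (hB : ∀ a b, B a b = B b a) (hU : IsOpen U)
    (hΦ : ContDiffOn ℝ ∞ Φ U) {v : EuclideanSpace ℝ (Fin n) → EuclideanSpace ℝ (Fin n)}
    (hv : ContDiffOn ℝ ∞ v U) {ξ : EuclideanSpace ℝ (Fin n) → E}
    (hξ : ContDiffOn ℝ ∞ ξ U) (hdec : ∀ y ∈ U, Φ y = fderiv ℝ Φ y (v y) + ξ y)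
    (hnor : ∀ y ∈ U, ∀ i, B (ξ y) (coordDeriv i Φ y) = 0) (hx : x ∈ U) (i j : Fin n) :
    coordLieDerivative (gramMatrix B Φ) v i j x =
      2 * (gramMatrix B Φ x i j - B (coordDeriv i ξ x) (coordDeriv j Φ x)) := by
  have hvd := hv.differentiableAt_of_mem hU hx
  have hξd := hξ.differentiableAt_of_mem hU hx
  have hvk : ∀ k, DifferentiableAt ℝ (fun y => v y k) x := fun k => by fun_prop
  have hP : ∀ k, DifferentiableAt ℝ (coordDeriv k Φ) x := fun k =>
    (hΦ.coordDeriv hU k).differentiableAt_of_mem hU hx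
  have hbr : ∀ i k, (VectorField.lieBracket ℝ v (fun _ => EuclideanSpace.single i 1) x) k =
      -partialDeriv i (fun y => v y k) x := by
    intro i k
    have h : HasFDerivAt (fun y => v y k) ((EuclideanSpace.proj k).comp (fderiv ℝ v x)) x :=
      (EuclideanSpace.proj (𝕜 := ℝ) k).hasFDerivAt.comp x hvd.hasFDerivAt
    simp [VectorField.lieBracket, partialDeriv, h.fderiv]
  -- Differentiate `Φ = dΦ(v) + ξ`; pairing with `∂ⱼΦ` will express the bracket terms of the Lie
  -- derivative.
  have hdΦ : ∀ i, coordDeriv i Φ x = ∑ k, (v x k • coordDeriv i (coordDeriv k Φ) x +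
      partialDeriv i (fun y => v y k) x • coordDeriv k Φ x) + coordDeriv i ξ x := by
    intro i
    have h1 : coordDeriv i Φ x =
        coordDeriv i (fun y => ∑ k, v y k • coordDeriv k Φ y + ξ y) x :=
      coordDeriv_congr hU (fun y hy => by
        rw [hdec y hy, fderiv_apply_eq_sum_coordDeriv]) hx i
    rw [h1]
    change fderiv ℝ (fun y => ∑ k, v y k • coordDeriv k Φ y + ξ y) x _ = _
    rw [fderiv_fun_add (DifferentiableAt.fun_sum fun k _ => (hvk k).fun_smul (hP k)) hξd,
      fderiv_fun_sum (fun k _ => (hvk k).fun_smul (hP k))]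
    simp only [add_apply, sum_apply]
    congr 1
    refine Finset.sum_congr rfl fun k _ => ?_
    rw [fderiv_fun_smul (hvk k) (hP k)]
    simp [partialDeriv, coordDeriv]
  -- Symmetry of the shape operator: differentiating `⟨ξ, ∂ⱼΦ⟩ = 0` identifies both sides with `-⟨ξ,
  -- ∂ᵢ∂ⱼΦ⟩`.
  have hsym : B (coordDeriv i ξ x) (coordDeriv j Φ x) =
      B (coordDeriv j ξ x) (coordDeriv i Φ x) := by
    have h0 : ∀ i j, B (ξ x) (coordDeriv i (coordDeriv j Φ) x) +
        B (coordDeriv i ξ x) (coordDeriv j Φ x) = 0 := by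
      intro i j
      rw [← partialDeriv_bilin B hξd (hP j),
        partialDeriv_congr hU (b := fun _ => 0) (fun y hy => hnor y hy j) hx]
      simp [partialDeriv]
    have h1 := h0 i j
    have h2 := h0 j i
    rw [coordDeriv_comm hU hΦ hx] at h1
    linarith
  have hi := congrArg (fun w => B w (coordDeriv j Φ x)) (hdΦ i)
  have hj := congrArg (fun w => B (coordDeriv i Φ x) w) (hdΦ j)
  simp only [map_add, map_sum, map_smul, add_apply,
    sum_apply, smul_apply, smul_eq_mul,
    Finset.sum_add_distrib] at hi hj
  have hv' : fderiv ℝ (fun y => gramMatrix B Φ y i j) x (v x) =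
      ∑ k, v x k * B (coordDeriv i (coordDeriv k Φ) x) (coordDeriv j Φ x) +
      ∑ k, v x k * B (coordDeriv i Φ x) (coordDeriv j (coordDeriv k Φ) x) := by
    rw [fderiv_apply_eq_sum_coordDeriv, ← Finset.sum_add_distrib]
    refine Finset.sum_congr rfl fun k _ => ?_
    have := partialDeriv_gramMatrix (B := B) hU hΦ hx k i j
    rw [partialDeriv] at this
    rw [coordDeriv, this, coordDeriv_comm hU hΦ hx k i, coordDeriv_comm hU hΦ hx k j, smul_eq_mul]
    ring
  have hij : B (coordDeriv i Φ x) (coordDeriv j ξ x) = B (coordDeriv i ξ x) (coordDeriv j Φ x) := by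
    rw [hB, hsym]
  rw [coordLieDerivative, hv']
  simp only [hbr, neg_mul, mul_neg, Finset.sum_neg_distrib]
  simp only [gramMatrix_apply, mul_comm (B _ _) (partialDeriv _ _ _)]
  rw [hij] at hj
  linarith

end Gauss

/-! ### Reading maps in a chart -/

section Chart

variable {n : ℕ} {M : Type*} [TopologicalSpace M] [ChartedSpace (EuclideanSpace ℝ (Fin n)) M]
  {E : Type*} [NormedAddCommGroup E] [NormedSpace ℝ E]
  {p : M} {y : EuclideanSpace ℝ (Fin n)}

/-- The differential of a vector-valued map on `M`, with the tangent space at `p` identified with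
`ℝⁿ` through the preferred chart. -/
noncomputable def vectorDeriv (n : ℕ) {M : Type*} [TopologicalSpace M]
    [ChartedSpace (EuclideanSpace ℝ (Fin n)) M] (h : M → E) (p : M) : EuclideanSpace ℝ (Fin n) →L[ℝ] E :=
  mfderiv (𝓡 n) 𝓘(ℝ, E) h p

theorem vectorDeriv_eq_fderiv_comp_extChartAt_symm {h : M → E}
    (hh : MDifferentiableAt (𝓡 n) 𝓘(ℝ, E) h p) :
    vectorDeriv n h p = fderiv ℝ (h ∘ (extChartAt (𝓡 n) p).symm) (extChartAt (𝓡 n) p p) := by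
  rw [vectorDeriv, hh.mfderiv]
  change fderivWithin ℝ (h ∘ (extChartAt (𝓡 n) p).symm) (range (𝓡 n)) _ = _
  rw [(𝓡 n).range_eq_univ, fderivWithin_univ]

/-- The differential of the inverse of the preferred chart around `p`. -/
noncomputable def chartSymmDeriv (n : ℕ) {M : Type*} [TopologicalSpace M]
    [ChartedSpace (EuclideanSpace ℝ (Fin n)) M] (p : M) (y : EuclideanSpace ℝ (Fin n)) :
    EuclideanSpace ℝ (Fin n) →L[ℝ] EuclideanSpace ℝ (Fin n) :=
  mfderivWithin 𝓘(ℝ, EuclideanSpace ℝ (Fin n)) (𝓡 n) (extChartAt (𝓡 n) p).symm (range (𝓡 n)) y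

variable [IsManifold (𝓡 n) ∞ M]

theorem chartSymmDeriv_vectorDeriv (hy : y ∈ (extChartAt (𝓡 n) p).target)
    (w : EuclideanSpace ℝ (Fin n)) :
    chartSymmDeriv n p y
      (vectorDeriv n (extChartAt (𝓡 n) p) ((extChartAt (𝓡 n) p).symm y) w) = w := by
  have : IsManifold (𝓡 n) 1 M := IsManifold.of_le (n := ∞) (by simp)
  exact DFunLike.congr_fun (mfderivWithin_extChartAt_symm_comp_mfderiv_extChartAt hy) w

theorem injective_chartSymmDeriv (hy : y ∈ (extChartAt (𝓡 n) p).target) :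
    Function.Injective (chartSymmDeriv n p y) := by
  have : IsManifold (𝓡 n) 1 M := IsManifold.of_le (n := ∞) (by simp)
  intro a b hab
  have h := mfderiv_extChartAt_comp_mfderivWithin_extChartAt_symm (I := 𝓡 n) hy
  rw [← ContinuousLinearMap.id_apply (R₁ := ℝ) a, ← ContinuousLinearMap.id_apply (R₁ := ℝ) b]
  refine (DFunLike.congr_fun h a).symm.trans (Eq.trans ?_ (DFunLike.congr_fun h b))
  exact congrArg (vectorDeriv n (extChartAt (𝓡 n) p)
    ((extChartAt (𝓡 n) p).symm y)) hab

theorem fderiv_comp_extChartAt_symm {h : M → E} (hy : y ∈ (extChartAt (𝓡 n) p).target)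
    (hh : MDifferentiableAt (𝓡 n) 𝓘(ℝ, E) h ((extChartAt (𝓡 n) p).symm y)) :
    fderiv ℝ (h ∘ (extChartAt (𝓡 n) p).symm) y =
      (vectorDeriv n h ((extChartAt (𝓡 n) p).symm y)).comp (chartSymmDeriv n p y) := by
  have : IsManifold (𝓡 n) 1 M := IsManifold.of_le (n := ∞) (by simp)
  have h1 := mfderiv_comp_mfderivWithin (I := 𝓘(ℝ, EuclideanSpace ℝ (Fin n))) y hh
    (mdifferentiableWithinAt_extChartAt_symm (I := 𝓡 n) hy)
    ((𝓡 n).uniqueMDiffOn y (by simp))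
  rw [show fderiv ℝ (h ∘ (extChartAt (𝓡 n) p).symm) y =
    mfderivWithin 𝓘(ℝ, EuclideanSpace ℝ (Fin n)) 𝓘(ℝ, E) (h ∘ (extChartAt (𝓡 n) p).symm)
      (range (𝓡 n)) y by
    rw [mfderivWithin_eq_fderivWithin]; simp]
  exact h1

theorem ContMDiff.contDiffOn_extChartAt_symm {h : M → E} (hh : ContMDiff (𝓡 n) 𝓘(ℝ, E) ∞ h)
    (p : M) : ContDiffOn ℝ ∞ (h ∘ (extChartAt (𝓡 n) p).symm) (extChartAt (𝓡 n) p).target :=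
  contMDiffOn_iff_contDiffOn.1 (hh.comp_contMDiffOn (contMDiffOn_extChartAt_symm p))

/-- On the chart domain, applying the differential of the chart is the same as applying the tangent
bundle trivialization, in which smoothness of a section is read off. -/
theorem contDiffOn_coordVectorField {v : (q : M) → TangentSpace (𝓡 n) q}
    (hv : ContMDiff (𝓡 n) (𝓡 n).tangent ∞ (fun q => (⟨q, v q⟩ : TangentBundle (𝓡 n) M)))
    (p : M) : ContDiffOn ℝ ∞ (PseudoRiemannianHypersurface.coordVectorField v p)
      (extChartAt (𝓡 n) p).target := by
  have : IsManifold (𝓡 n) 1 M := IsManifold.of_le (n := ∞) (by simp)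
  have h1 : ContMDiffOn (𝓡 n) 𝓘(ℝ, EuclideanSpace ℝ (Fin n)) ∞
      (fun q => (trivializationAt (EuclideanSpace ℝ (Fin n)) (TangentSpace (𝓡 n)) p ⟨q, v q⟩).2)
      (chartAt (EuclideanSpace ℝ (Fin n)) p).source :=
    (((trivializationAt (EuclideanSpace ℝ (Fin n))
      (TangentSpace (𝓡 n) : M → Type _) p).contMDiffOn_section_iff
        (chartAt _ p).open_source (TangentBundle.trivializationAt_baseSet (I := 𝓡 n) p).ge).1 hv.contMDiffOn :)
  refine contMDiffOn_iff_contDiffOn.1 ((h1.comp (contMDiffOn_extChartAt_symm p) ?_).congr ?_)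
  · intro y hy
    simpa using (extChartAt (𝓡 n) p).map_target hy
  · intro y hy
    have hs : (extChartAt (𝓡 n) p).symm y ∈ (chartAt (EuclideanSpace ℝ (Fin n)) p).source := by
      simpa using (extChartAt (𝓡 n) p).map_target hy
    rw [PseudoRiemannianHypersurface.coordVectorField,
      ← TangentBundle.continuousLinearMapAt_trivializationAt hs]
    exact congrFun (Bundle.Trivialization.coe_linearMapAt_of_mem (R := ℝ)
      (trivializationAt (EuclideanSpace ℝ (Fin n)) (TangentSpace (𝓡 n) : M → Type _) p)
      ((TangentBundle.trivializationAt_baseSet (I := 𝓡 n) p).ge hs)) _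

/-- A differentiable function is locally constant where its differential vanishes. -/
theorem eventually_eq_of_vectorDeriv_eq_zero {h : M → E}
    (hh : MDifferentiable (𝓡 n) 𝓘(ℝ, E) h)
    (h0 : ∀ᶠ q in nhds p, vectorDeriv n h q = 0) : ∀ᶠ q in nhds p, h q = h p := by
  set e := extChartAt (𝓡 n) p with he
  have hc : ContinuousAt e.symm (e p) := continuousAt_extChartAt_symm p
  have ht : e.target ∈ nhds (e p) := extChartAt_target_mem_nhds p
  have hep : e.symm (e p) = p := extChartAt_to_inv p
  have h0' : ∀ᶠ y in nhds (e p), y ∈ e.target ∧ vectorDeriv n h (e.symm y) = 0 :=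
    Filter.Eventually.and ht (hc.eventually (by rwa [hep]))
  -- A ball is chosen because its convexity allows the mean value argument.
  obtain ⟨r, hr, hball⟩ := Metric.eventually_nhds_iff_ball.1 h0'
  have hconst : ∀ y ∈ Metric.ball (e p) r, h (e.symm y) = h p := by
    intro y hy
    have hd : DifferentiableOn ℝ (h ∘ e.symm) (Metric.ball (e p) r) := by
      intro z hz
      have hm : MDifferentiableWithinAt 𝓘(ℝ, EuclideanSpace ℝ (Fin n)) 𝓘(ℝ, E) (h ∘ e.symm)
          (range (𝓡 n)) z :=
        (hh (e.symm z)).comp_mdifferentiableWithinAt z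
          (have : IsManifold (𝓡 n) 1 M := IsManifold.of_le (n := ∞) (by simp)
          mdifferentiableWithinAt_extChartAt_symm (hball z hz).1)
      exact hm.differentiableWithinAt.mono (by simp)
    have := (convex_ball (e p) r).is_const_of_fderivWithin_eq_zero hd (fun z hz => ?_) hy
      (Metric.mem_ball_self hr)
    · simpa [hep] using this
    · rw [fderivWithin_of_isOpen Metric.isOpen_ball hz]
      rw [fderiv_comp_extChartAt_symm (hball z hz).1 (hh _), (hball z hz).2,
        ContinuousLinearMap.zero_comp]
  filter_upwards [extChartAt_source_mem_nhds (I := 𝓡 n) p,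
    (continuousAt_extChartAt (I := 𝓡 n) p).eventually (Metric.ball_mem_nhds _ hr)] with q hq hq'
  rw [← hconst _ hq', e.left_inv hq]

theorem eq_of_forall_vectorDeriv_eq_zero [PreconnectedSpace M] {h : M → E}
    (hh : MDifferentiable (𝓡 n) 𝓘(ℝ, E) h)
    (h0 : ∀ q, vectorDeriv n h q = 0) (p q : M) : h p = h q :=
  ((IsLocallyConstant.iff_eventually_eq h).2 fun _ =>
    eventually_eq_of_vectorDeriv_eq_zero hh (.of_forall h0)).apply_eq_of_isPreconnected
      isPreconnected_univ (mem_univ p) (mem_univ q)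

end Chart

/-! ### The Codazzi equation -/

section Codazzi

variable {n s : ℕ} {Φ ξ : EuclideanSpace ℝ (Fin n) → AmbientSpace n}
  {U : Set (EuclideanSpace ℝ (Fin n))} {x : EuclideanSpace ℝ (Fin n)}
  {μ : EuclideanSpace ℝ (Fin n) → ℝ}

/-- A kernel vector of `dΦ` would be annihilated by the invertible Gram matrix. -/
theorem injective_fderiv_of_det_gramMatrix_ne_zero
    (hdet : (gramMatrix (pseudoFormL n s) Φ x).det ≠ 0) :
    Function.Injective (fderiv ℝ Φ x) := by
  rw [injective_iff_map_eq_zero]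
  intro a ha
  have h : Matrix.vecMul a.ofLp (gramMatrix (pseudoFormL n s) Φ x) = 0 := by
    funext j
    have h1 := congrArg (fun w => pseudoFormL n s w (coordDeriv j Φ x)) ha
    rw [fderiv_apply_eq_sum_coordDeriv] at h1
    simpa [Matrix.vecMul, dotProduct, gramMatrix_apply] using h1
  have h2 : a.ofLp = 0 := Matrix.eq_zero_of_vecMul_eq_zero hdet h
  ext i
  exact congrFun h2 i

theorem pseudoFormL_fderiv_eq_zero {w : AmbientSpace n}
    (h : ∀ i, pseudoFormL n s w (coordDeriv i Φ x) = 0) (a : EuclideanSpace ℝ (Fin n)) :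
    pseudoFormL n s w (fderiv ℝ Φ x a) = 0 := by
  rw [fderiv_apply_eq_sum_coordDeriv, map_sum]
  exact Finset.sum_eq_zero fun i _ => by rw [map_smul, h, smul_zero]

theorem pseudoFormL_normal_second_deriv (hU : IsOpen U) (hΦ : ContDiffOn ℝ ∞ Φ U)
    (hξ : ContDiffOn ℝ ∞ ξ U)
    (hnor : ∀ y ∈ U, ∀ i, pseudoFormL n s (ξ y) (coordDeriv i Φ y) = 0) (hx : x ∈ U)
    (i j : Fin n) :
    pseudoFormL n s (ξ x) (coordDeriv i (coordDeriv j Φ) x) =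
      -pseudoFormL n s (coordDeriv i ξ x) (coordDeriv j Φ x) := by
  rw [eq_neg_iff_add_eq_zero, ← partialDeriv_bilin _ (hξ.differentiableAt_of_mem hU hx)
    ((hΦ.coordDeriv hU j).differentiableAt_of_mem hU hx),
    partialDeriv_congr hU (b := fun _ => 0) (fun y hy => hnor y hy j) hx]
  simp [partialDeriv]

/-- The scalar curvature when the second fundamental form is `(μ/f) g ξ`, with `f = ⟨ξ, ξ⟩`. -/
theorem coordScalarCurvature_of_normal (hU : IsOpen U) (hΦ : ContDiffOn ℝ ∞ Φ U)
    (hξ : ContDiffOn ℝ ∞ ξ U)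
    (hnor : ∀ y ∈ U, ∀ i, pseudoFormL n s (ξ y) (coordDeriv i Φ y) = 0)
    (hdet : ∀ y ∈ U, (gramMatrix (pseudoFormL n s) Φ y).det ≠ 0) (hx : x ∈ U) {m : ℝ}
    (hm : ∀ i j, pseudoFormL n s (coordDeriv i ξ x) (coordDeriv j Φ x) =
      -(m * gramMatrix (pseudoFormL n s) Φ x i j))
    (hf : pseudoFormL n s (ξ x) (ξ x) ≠ 0) :
    coordScalarCurvature (gramMatrix (pseudoFormL n s) Φ) x * pseudoFormL n s (ξ x) (ξ x) =
      n * (n - 1) * m ^ 2 := by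
  have hB := pseudoFormL_comm n s
  -- The second fundamental form is normal, hence fixed by its product with `ξ`, which is `⟨ξ,
  -- ∂ᵢ∂ⱼΦ⟩ = -⟨∂ᵢξ, ∂ⱼΦ⟩`.
  have hII : ∀ i j, secondFundamentalForm (pseudoFormL n s) Φ i j x =
      (m * gramMatrix (pseudoFormL n s) Φ x i j / pseudoFormL n s (ξ x) (ξ x)) • ξ x := by
    intro i j
    have h : pseudoFormL n s (secondFundamentalForm (pseudoFormL n s) Φ i j x) (ξ x) =
        m * gramMatrix (pseudoFormL n s) Φ x i j := by
      rw [hB, secondFundamentalForm, map_sub, map_sum,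
        pseudoFormL_normal_second_deriv hU hΦ hξ hnor hx, hm]
      simp [hnor x hx]
    rw [← h]
    exact normal_eq_smul (injective_fderiv_of_det_gramMatrix_ne_zero (hdet x hx))
      (pseudoFormL_fderiv_eq_zero (hnor x hx)) hf (pseudoFormL_fderiv_eq_zero fun l => by
        rw [hB, secondFundamentalForm_normal hB hU hΦ hdet hx])
  rw [coordScalarCurvature_of_umbilical hB hU hΦ hdet hx (m ^ 2 / pseudoFormL n s (ξ x) (ξ x))]
  · field_simp
  · intro i p j k
    rw [hII, hII]
    simp only [map_smul, smul_apply, smul_eq_mul]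
    field_simp

/-- Where the position vector has a non-null normal part `ξ`, the soliton equation and the Yamabe
equation force `dξ = -μ dΦ` and `dμ = 0`, and either `μ = 0` or the position is normal. -/
theorem rigidity_of_yamabe (hn : 2 ≤ n) (hU : IsOpen U) (hΦ : ContDiffOn ℝ ∞ Φ U)
    (hξ : ContDiffOn ℝ ∞ ξ U) (hμ : ContDiffOn ℝ ∞ μ U)
    (hnor : ∀ y ∈ U, ∀ i, pseudoFormL n s (ξ y) (coordDeriv i Φ y) = 0)
    (hξΦ : ∀ y ∈ U, pseudoFormL n s (ξ y) (ξ y) = pseudoFormL n s (ξ y) (Φ y))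
    (hdet : ∀ y ∈ U, (gramMatrix (pseudoFormL n s) Φ y).det ≠ 0)
    (hsol : ∀ y ∈ U, ∀ i j, pseudoFormL n s (coordDeriv i ξ y) (coordDeriv j Φ y) =
      -(μ y * gramMatrix (pseudoFormL n s) Φ y i j)) (ρ : ℝ)
    (hyam : ∀ y ∈ U, (μ y + ρ) * pseudoFormL n s (ξ y) (ξ y) = n * (n - 1) * (μ y * μ y))
    (hx : x ∈ U) (hf : pseudoFormL n s (ξ x) (ξ x) ≠ 0) (k : Fin n) :
    coordDeriv k ξ x = -(μ x • coordDeriv k Φ x) ∧ partialDeriv k μ x = 0 ∧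
      (μ x = 0 ∨ pseudoFormL n s (Φ x) (coordDeriv k Φ x) = 0) := by
  have hB := pseudoFormL_comm n s
  have hξd := hξ.differentiableAt_of_mem hU hx
  have hΦd := hΦ.differentiableAt_of_mem hU hx
  have hμd := hμ.differentiableAt_of_mem hU hx
  have hP : ∀ i, DifferentiableAt ℝ (coordDeriv i Φ) x := fun i =>
    (hΦ.coordDeriv hU i).differentiableAt_of_mem hU hx
  have hQ : ∀ i, DifferentiableAt ℝ (coordDeriv i ξ) x := fun i =>
    (hξ.coordDeriv hU i).differentiableAt_of_mem hU hx
  have hG : ∀ i j, DifferentiableAt ℝ (fun y => gramMatrix (pseudoFormL n s) Φ y i j) x :=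
    fun i j => (contDiffAt_gramMatrix hU hΦ hx i j).differentiableAt (by simp)
  -- By the soliton equation `∂ᵢξ + μ ∂ᵢΦ` is normal, hence a multiple of the non-null vector `ξ`.
  have hc : ∀ i, ∃ c : ℝ, coordDeriv i ξ x = c • ξ x - μ x • coordDeriv i Φ x := by
    intro i
    refine ⟨_, eq_sub_of_add_eq <| normal_eq_smul (s := s)
      (injective_fderiv_of_det_gramMatrix_ne_zero (hdet x hx))
      (pseudoFormL_fderiv_eq_zero (hnor x hx)) hf
      (pseudoFormL_fderiv_eq_zero (w := coordDeriv i ξ x + μ x • coordDeriv i Φ x) fun j => ?_)⟩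
    simp only [map_add, map_smul, add_apply, smul_apply, hsol x hx, smul_eq_mul, gramMatrix_apply]
    ring
  choose c hc using hc
  -- Derivative of the soliton equation in direction `k`; the last term comes from the component `cᵢ
  -- ξ` paired with `∂ₖ∂ⱼΦ`.
  have hcod : ∀ i j k, pseudoFormL n s (coordDeriv k (coordDeriv i ξ) x) (coordDeriv j Φ x) =
      -(partialDeriv k μ x * gramMatrix (pseudoFormL n s) Φ x i j +
        μ x * pseudoFormL n s (coordDeriv k (coordDeriv i Φ) x) (coordDeriv j Φ x) +
        c i * μ x * gramMatrix (pseudoFormL n s) Φ x k j) := by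
    intro i j k
    have h := partialDeriv_congr hU (fun y hy => hsol y hy i j) hx k
    have hneg : partialDeriv k (fun y => -(μ y * gramMatrix (pseudoFormL n s) Φ y i j)) x =
        -partialDeriv k (fun y => μ y * gramMatrix (pseudoFormL n s) Φ y i j) x := by
      simp [partialDeriv]
    rw [hneg, partialDeriv_mul hμd (hG i j), partialDeriv_bilin _ (hQ i) (hP j),
      partialDeriv_gramMatrix hU hΦ hx, hc i] at h
    simp only [map_sub, map_smul, sub_apply, smul_apply, smul_eq_mul,
      pseudoFormL_normal_second_deriv hU hΦ hξ hnor hx, hsol x hx] at h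
    linarith
  have hμc : ∀ k, partialDeriv k μ x = c k * μ x := by
    intro k
    have : Nontrivial (Fin n) := Fin.nontrivial_iff_two_le.2 hn
    obtain ⟨i, hik⟩ := exists_ne k
    -- Codazzi: antisymmetrize in `i` and `k`. Rows `i ≠ k` of an invertible matrix are independent,
    -- so both coefficients vanish; contraction with column `i` of the inverse isolates the one for
    -- `k`.
    have hrow : ∀ j, (c k * μ x - partialDeriv k μ x) * gramMatrix (pseudoFormL n s) Φ x i j =
        (c i * μ x - partialDeriv i μ x) * gramMatrix (pseudoFormL n s) Φ x k j := by
      intro j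
      have h1 := hcod i j k
      have h2 := hcod k j i
      rw [coordDeriv_comm hU hξ hx, coordDeriv_comm hU hΦ hx] at h1
      linarith
    have hinv := Matrix.mul_nonsing_inv (gramMatrix (pseudoFormL n s) Φ x) (hdet x hx).isUnit
    have h1 := congrFun (congrFun hinv i) i
    have h2 := congrFun (congrFun hinv k) i
    rw [Matrix.mul_apply, Matrix.one_apply_eq] at h1
    rw [Matrix.mul_apply, Matrix.one_apply_ne hik.symm] at h2
    have h3 : (c k * μ x - partialDeriv k μ x) * 1 = (c i * μ x - partialDeriv i μ x) * 0 := by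
      rw [← h1, ← h2, Finset.mul_sum, Finset.mul_sum]
      exact Finset.sum_congr rfl fun j _ => by rw [← mul_assoc, hrow, mul_assoc]
    linarith
  have hξc : ∀ k, pseudoFormL n s (coordDeriv k ξ x) (ξ x) =
      c k * pseudoFormL n s (ξ x) (ξ x) := by
    intro k
    rw [hc k, hB]
    simp [hnor x hx]
  have hfd : DifferentiableAt ℝ (fun y => pseudoFormL n s (ξ y) (ξ y)) x :=
    ((pseudoFormL n s).hasFDerivAt_of_bilinear hξd.hasFDerivAt hξd.hasFDerivAt).differentiableAt
  have hy := partialDeriv_congr hU hyam hx k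
  have hadd : partialDeriv k (fun y => μ y + ρ) x = partialDeriv k μ x := by
    simp [partialDeriv]
  have hcm : partialDeriv k (fun y => (n : ℝ) * (n - 1) * (μ y * μ y)) x =
      n * (n - 1) * partialDeriv k (fun y => μ y * μ y) x := by
    simp only [partialDeriv]
    rw [fderiv_const_mul (hμd.fun_mul hμd)]
    rfl
  rw [hcm, partialDeriv_mul (hμd.add_const ρ) hfd, hadd, partialDeriv_mul hμd hμd, hμc,
    partialDeriv_bilin _ hξd hξd, hB (ξ x) (coordDeriv k ξ x), hξc] at hy
  have hcμ : c k * μ x = 0 := by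
    have h1 := hyam x hx
    have : c k * μ x * pseudoFormL n s (ξ x) (ξ x) = 0 := by
      -- Every term of the differentiated relation is `2 cₖ` times the matching term of the
      -- original, except that `μ f` acquires `3 cₖ`; subtraction leaves `cₖ μ f`.
      linear_combination hy - 2 * c k * h1
    exact (mul_eq_zero.1 this).resolve_right hf
  have hθ : c k * pseudoFormL n s (ξ x) (ξ x) =
      -(μ x * pseudoFormL n s (Φ x) (coordDeriv k Φ x)) := by
    have h := partialDeriv_congr hU hξΦ hx k
    rw [partialDeriv_bilin _ hξd hξd, partialDeriv_bilin _ hξd hΦd, hB (ξ x) (coordDeriv k ξ x),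
      hξc, hnor x hx, hc k] at h
    simp only [map_sub, map_smul, sub_apply, smul_apply, smul_eq_mul, ← hξΦ x hx] at h
    rw [hB (Φ x)]
    linarith
  have hck : c k = 0 := by
    rcases mul_eq_zero.1 hcμ with h | h
    · exact h
    · rw [h, zero_mul, neg_zero] at hθ
      exact (mul_eq_zero.1 hθ).resolve_right hf
  refine ⟨by rw [hc k, hck, zero_smul, zero_sub], by rw [hμc, hck, zero_mul], ?_⟩
  rw [hck, zero_mul] at hθ
  exact mul_eq_zero.1 (neg_eq_zero.1 hθ.symm)

end Codazzi

/-! ### Yamabe solitons on hypersurfaces -/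

namespace PseudoRiemannianHypersurface

section Soliton

variable {n s : ℕ} {M : Type*} [TopologicalSpace M]
  [ChartedSpace (EuclideanSpace ℝ (Fin n)) M]

/-- The normal part of the position vector. -/
noncomputable def normalPosition (F : PseudoRiemannianHypersurface n s M) (p : M) :
    AmbientSpace n :=
  F.position p - F.differential p (F.tangentialPosition p)

theorem pseudoFormL_normalPosition_vectorDeriv (F : PseudoRiemannianHypersurface n s M) (p : M)
    (w : EuclideanSpace ℝ (Fin n)) :
    pseudoFormL n s (F.normalPosition p) (vectorDeriv n F.position p w) = 0 :=
  F.normal_position_sub_tangentialPosition p w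

/-- The tangential part of the position vector, as an element of `ℝⁿ`. -/
noncomputable def tangentialVector (F : PseudoRiemannianHypersurface n s M) (p : M) :
    EuclideanSpace ℝ (Fin n) :=
  F.tangentialPosition p

theorem position_eq_add_normalPosition (F : PseudoRiemannianHypersurface n s M) (p : M) :
    F.position p = vectorDeriv n F.position p (F.tangentialVector p) + F.normalPosition p :=
  (add_sub_cancel (F.differential p (F.tangentialPosition p)) (F.position p)).symm

theorem pseudoFormL_normalPosition_self (F : PseudoRiemannianHypersurface n s M) (p : M) :
    pseudoFormL n s (F.normalPosition p) (F.normalPosition p) =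
      pseudoFormL n s (F.normalPosition p) (F.position p) := by
  conv_rhs => rw [F.position_eq_add_normalPosition p]
  rw [map_add, F.pseudoFormL_normalPosition_vectorDeriv, zero_add]

theorem eq_zero_of_vectorDeriv_position (F : PseudoRiemannianHypersurface n s M) (p : M)
    (u : EuclideanSpace ℝ (Fin n)) (hu : ∀ w, pseudoFormL n s (vectorDeriv n F.position p u)
      (vectorDeriv n F.position p w) = 0) : u = 0 :=
  F.nondegenerate p u hu

theorem injective_vectorDeriv_position (F : PseudoRiemannianHypersurface n s M) (p : M) :
    Function.Injective (vectorDeriv n F.position p) := by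
  rw [injective_iff_map_eq_zero]
  exact fun u hu => F.eq_zero_of_vectorDeriv_position p u fun w => by simp [hu]

theorem normalPosition_eq_zero_of_null (F : PseudoRiemannianHypersurface n s M) (p : M)
    (h : pseudoFormL n s (F.normalPosition p) (F.normalPosition p) = 0) :
    F.normalPosition p = 0 :=
  normal_eq_zero_of_null (F.injective_vectorDeriv_position p)
    (F.eq_zero_of_vectorDeriv_position p) (F.pseudoFormL_normalPosition_vectorDeriv p) h

theorem mdifferentiableAt_position (F : PseudoRiemannianHypersurface n s M) (p : M) :
    MDifferentiableAt (𝓡 n) 𝓘(ℝ, AmbientSpace n) F.position p :=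
  F.contMDiff_position.mdifferentiableAt (by simp)

theorem contMDiff_pseudoFormL_self {h : M → AmbientSpace n}
    (hh : ContMDiff (𝓡 n) 𝓘(ℝ, AmbientSpace n) ∞ h) :
    ContMDiff (𝓡 n) 𝓘(ℝ, ℝ) ∞ (fun q => pseudoFormL n s (h q) (h q)) :=
  (pseudoFormL n s).isBoundedBilinearMap.contDiff.contMDiff.comp (hh.prodMk_space hh)

/-- When `ξ = 0` the position is its own velocity along an integral curve, so `e⁻ᵗ` times the
position has zero derivative. -/
theorem position_integralCurve {F : PseudoRiemannianHypersurface n s M}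
    (hξ : ∀ q, F.normalPosition q = 0) {γ : ℝ → M} (hγ : IsMIntegralCurve γ F.tangentialPosition)
    (t : ℝ) :
    F.position (γ t) = Real.exp t • F.position (γ 0) := by
  have hd : ∀ t, HasDerivAt (fun t => F.position (γ t)) (F.position (γ t)) t := by
    intro t
    have h := ((F.contMDiff_position.mdifferentiableAt (by simp)).hasMFDerivAt).comp t (hγ t)
    have h1 : HasFDerivAt (fun t => F.position (γ t))
        ((vectorDeriv n F.position (γ t)).comp
          ((1 : ℝ →L[ℝ] ℝ).smulRight (F.tangentialVector (γ t)))) t :=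
      hasMFDerivAt_iff_hasFDerivAt.1 h
    refine h1.hasDerivAt.congr_deriv ?_
    conv_rhs => rw [F.position_eq_add_normalPosition (γ t), hξ, add_zero]
    exact congrArg (vectorDeriv n F.position (γ t))
      (one_smul ℝ (F.tangentialVector (γ t)))
  have hd' : ∀ t, HasDerivAt (fun t => Real.exp (-t) • F.position (γ t)) 0 t := by
    intro t
    have h : HasDerivAt (fun t => Real.exp (-t)) (Real.exp (-t) * -1) t := (hasDerivAt_neg t).exp
    refine (h.smul (hd t)).congr_deriv ?_
    simp
  have := is_const_of_deriv_eq_zero (fun t => (hd' t).differentiableAt)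
    (fun t => (hd' t).deriv) t 0
  simp only [neg_zero, Real.exp_zero, one_smul] at this
  rw [← this, smul_smul, ← Real.exp_add, add_neg_cancel, Real.exp_zero, one_smul]

variable [IsManifold (𝓡 n) ∞ M]

theorem contMDiff_normalPosition (F : PseudoRiemannianHypersurface n s M)
    (hV : ContMDiff (𝓡 n) (𝓡 n).tangent ∞
      (fun q => (⟨q, F.tangentialPosition q⟩ : TangentBundle (𝓡 n) M))) :
    ContMDiff (𝓡 n) 𝓘(ℝ, AmbientSpace n) ∞ F.normalPosition := by
  have : IsManifold (𝓡 n) 1 M := IsManifold.of_le (n := ∞) (by simp)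
  have hT := (F.contMDiff_position.contMDiff_tangentMap (m := ∞) le_rfl).comp hV
  exact F.contMDiff_position.sub
    ((contMDiff_snd_tangentBundle_modelSpace (AmbientSpace n) 𝓘(ℝ, AmbientSpace n)).comp hT)

theorem vectorDeriv_pseudoFormL_self {h : M → AmbientSpace n}
    (hh : ContMDiff (𝓡 n) 𝓘(ℝ, AmbientSpace n) ∞ h) (p : M) (a : EuclideanSpace ℝ (Fin n)) :
    vectorDeriv n (fun q => pseudoFormL n s (h q) (h q)) p a =
      2 * pseudoFormL n s (h p) (vectorDeriv n h p a) := by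
  have hd : DifferentiableAt ℝ (h ∘ (extChartAt (𝓡 n) p).symm) (extChartAt (𝓡 n) p p) :=
    (hh.contDiffOn_extChartAt_symm p).differentiableAt_of_mem (isOpen_extChartAt_target p)
      (mem_extChartAt_target p)
  have hs := contMDiff_pseudoFormL_self (s := s) hh
  rw [vectorDeriv_eq_fderiv_comp_extChartAt_symm (hs.mdifferentiableAt (by simp)),
    vectorDeriv_eq_fderiv_comp_extChartAt_symm (hh.mdifferentiableAt (by simp))]
  refine (DFunLike.congr_fun ((pseudoFormL n s).fderiv_of_bilinear hd hd) a).trans ?_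
  rw [add_apply, ContinuousLinearMap.precompR_apply, ContinuousLinearMap.precompL_apply,
    ContinuousLinearMap.compL_apply, ContinuousLinearMap.comp_apply, Function.comp_apply, extChartAt_to_inv, pseudoFormL_comm n s _ (h p)]
  ring

/-- A null vector of the Gram matrix, carried to `M` by the inverse chart, would lie in the radical
of `g`. This holds on the whole chart, not only at its centre. -/
theorem det_gramMatrix_localRep_ne_zero (F : PseudoRiemannianHypersurface n s M) {p : M}
    {y : EuclideanSpace ℝ (Fin n)} (hy : y ∈ (extChartAt (𝓡 n) p).target) :
    (gramMatrix (pseudoFormL n s) (F.localRep p) y).det ≠ 0 := by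
  intro h0
  obtain ⟨v, hv0, hv⟩ := Matrix.exists_mulVec_eq_zero_iff.2 h0
  have hz : ∀ i, pseudoFormL n s (fderiv ℝ (F.localRep p) y (WithLp.toLp 2 v))
      (coordDeriv i (F.localRep p) y) = 0 := by
    intro i
    rw [pseudoFormL_comm, fderiv_apply_eq_sum_coordDeriv, map_sum]
    refine Eq.trans (Finset.sum_congr rfl fun j _ => ?_) (congrFun hv i)
    exact (map_smul _ _ _).trans (mul_comm _ _)
  have ha : chartSymmDeriv n p y (WithLp.toLp 2 v) = 0 := by
    refine F.eq_zero_of_vectorDeriv_position ((extChartAt (𝓡 n) p).symm y) _ fun w => ?_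
    have h1 := pseudoFormL_fderiv_eq_zero hz
      (vectorDeriv n (extChartAt (𝓡 n) p) ((extChartAt (𝓡 n) p).symm y) w)
    rwa [localRep, fderiv_comp_extChartAt_symm hy (F.mdifferentiableAt_position _),
      ContinuousLinearMap.comp_apply, ContinuousLinearMap.comp_apply,
      chartSymmDeriv_vectorDeriv hy] at h1
  have h2 := injective_chartSymmDeriv hy (ha.trans (map_zero _).symm)
  exact hv0 (congrArg WithLp.ofLp h2)

variable {F : PseudoRiemannianHypersurface n s M} {φ : M → ℝ}

theorem pseudoFormL_normalPosition_coordDeriv (F : PseudoRiemannianHypersurface n s M) {p : M}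
    {y : EuclideanSpace ℝ (Fin n)} (hy : y ∈ (extChartAt (𝓡 n) p).target) (i : Fin n) :
    pseudoFormL n s ((F.normalPosition ∘ (extChartAt (𝓡 n) p).symm) y)
      (coordDeriv i (F.localRep p) y) = 0 := by
  rw [coordDeriv, localRep, fderiv_comp_extChartAt_symm hy (F.mdifferentiableAt_position _)]
  exact F.pseudoFormL_normalPosition_vectorDeriv _ _

/-- The soliton equation in the preferred chart, at its centre:
`⟨∂ᵢξ, ∂ⱼΦ⟩ = -(φ - 1) g_ij` for the normal part `ξ` of the position. -/
theorem IsConformalSoliton.coordDeriv_normalPosition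
    (hF : F.IsConformalSoliton F.tangentialPosition φ) (p : M) (i j : Fin n) :
    pseudoFormL n s
        (coordDeriv i (F.normalPosition ∘ (extChartAt (𝓡 n) p).symm) (extChartAt (𝓡 n) p p))
        (coordDeriv j (F.localRep p) (extChartAt (𝓡 n) p p)) =
      -((φ p - 1) * gramMatrix (pseudoFormL n s) (F.localRep p) (extChartAt (𝓡 n) p p) i j) := by
  have hξ := (F.contMDiff_normalPosition hF.smooth_vectorField).contDiffOn_extChartAt_symm p
  have h := hF.equation p i j
  have hdec : ∀ y ∈ (extChartAt (𝓡 n) p).target, F.localRep p y =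
      fderiv ℝ (F.localRep p) y (coordVectorField F.tangentialPosition p y) +
        (F.normalPosition ∘ (extChartAt (𝓡 n) p).symm) y := by
    intro y hy
    rw [localRep, fderiv_comp_extChartAt_symm hy (F.mdifferentiableAt_position _),
      ContinuousLinearMap.comp_apply]
    refine (F.position_eq_add_normalPosition _).trans ?_
    congr 2
    exact (chartSymmDeriv_vectorDeriv hy _).symm
  have hL := coordLieDerivative_tangential (pseudoFormL_comm n s) (isOpen_extChartAt_target p)
    (F.contMDiff_position.contDiffOn_extChartAt_symm p)
    (contDiffOn_coordVectorField hF.smooth_vectorField p) hξ hdec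
    (fun y hy => F.pseudoFormL_normalPosition_coordDeriv hy)
    (mem_extChartAt_target (I := 𝓡 n) p) i j
  change φ p * gramMatrix (pseudoFormL n s) (F.localRep p) _ i j = 1 / 2 *
    coordLieDerivative (gramMatrix (pseudoFormL n s) (F.localRep p)) _ i j _ at h
  rw [localRep] at h ⊢
  rw [hL] at h
  linarith

/-- The soliton equation is given only at the centre of each preferred chart. This chart-free form
can be pulled back by the chain rule to all points of one fixed chart, where it may be
differentiated. -/
theorem IsConformalSoliton.vectorDeriv_normalPosition
    (hF : F.IsConformalSoliton F.tangentialPosition φ) (p : M)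
    (a b : EuclideanSpace ℝ (Fin n)) :
    pseudoFormL n s (vectorDeriv n F.normalPosition p a) (vectorDeriv n F.position p b) =
      -((φ p - 1) * pseudoFormL n s (vectorDeriv n F.position p a)
        (vectorDeriv n F.position p b)) := by
  rw [vectorDeriv_eq_fderiv_comp_extChartAt_symm (F.mdifferentiableAt_position p),
    vectorDeriv_eq_fderiv_comp_extChartAt_symm
      ((F.contMDiff_normalPosition hF.smooth_vectorField).mdifferentiableAt (by simp)),
    fderiv_apply_eq_sum_coordDeriv _ _ a, fderiv_apply_eq_sum_coordDeriv _ _ b,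
    fderiv_apply_eq_sum_coordDeriv _ _ a]
  simp only [map_sum, map_smul, sum_apply, smul_apply, smul_eq_mul, Finset.mul_sum,
    ← Finset.sum_neg_distrib]
  refine Finset.sum_congr rfl fun i _ => Finset.sum_congr rfl fun j _ => ?_
  have h := hF.coordDeriv_normalPosition p j i
  rw [gramMatrix_apply, localRep] at h
  rw [h]
  ring

/-- Evaluating at the centre of the chart of each point yields a relation between functions on `M`,
so invariance of scalar curvature under change of chart is never needed. -/
theorem IsYamabeSoliton.scalarCurvature_mul (hF : F.IsYamabeSoliton F.tangentialPosition φ)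
    (p : M) (hf : pseudoFormL n s (F.normalPosition p) (F.normalPosition p) ≠ 0) :
    F.scalarCurvature p * pseudoFormL n s (F.normalPosition p) (F.normalPosition p) =
      n * (n - 1) * (φ p - 1) ^ 2 := by
  have hp : (F.normalPosition ∘ (extChartAt (𝓡 n) p).symm) (extChartAt (𝓡 n) p p) =
    F.normalPosition p := by simp
  have h := coordScalarCurvature_of_normal (isOpen_extChartAt_target p)
    (F.contMDiff_position.contDiffOn_extChartAt_symm p)
    ((F.contMDiff_normalPosition hF.1.smooth_vectorField).contDiffOn_extChartAt_symm p)
    (fun y hy => F.pseudoFormL_normalPosition_coordDeriv hy)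
    (fun y hy => F.det_gramMatrix_localRep_ne_zero hy) (mem_extChartAt_target p)
    (hF.1.coordDeriv_normalPosition p) (by rwa [hp])
  rw [hp] at h
  exact h

theorem IsYamabeSoliton.rigidity (hn : 2 ≤ n) (hF : F.IsYamabeSoliton F.tangentialPosition φ)
    (p : M) (hf : pseudoFormL n s (F.normalPosition p) (F.normalPosition p) ≠ 0) :
    vectorDeriv n F.normalPosition p =
        -((φ p - 1) • vectorDeriv n F.position p) ∧
      vectorDeriv n φ p = 0 ∧
      (φ p = 1 ∨ ∀ a, pseudoFormL n s (F.position p)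
        (vectorDeriv n F.position p a) = 0) := by
  obtain ⟨hS, ρ, hρ⟩ := hF
  have hξM := F.contMDiff_normalPosition hS.smooth_vectorField
  have hξd : ∀ q, MDifferentiableAt (𝓡 n) 𝓘(ℝ, AmbientSpace n) F.normalPosition q :=
    fun q => hξM.mdifferentiableAt (by simp)
  have hPd := F.mdifferentiableAt_position
  have hφd : MDifferentiableAt (𝓡 n) 𝓘(ℝ, ℝ) φ p := hS.smooth_function.mdifferentiableAt (by simp)
  set e := extChartAt (𝓡 n) p with he
  have hep : e.symm (e p) = p := extChartAt_to_inv p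
  have hΦ := F.contMDiff_position.contDiffOn_extChartAt_symm p
  have hξ := hξM.contDiffOn_extChartAt_symm p
  have hφ := hS.smooth_function.contDiffOn_extChartAt_symm p
  let g : EuclideanSpace ℝ (Fin n) → ℝ := fun y =>
    pseudoFormL n s ((F.normalPosition ∘ e.symm) y) ((F.normalPosition ∘ e.symm) y)
  have hg : ContinuousOn g e.target :=
    (contMDiff_pseudoFormL_self hξM).contDiffOn_extChartAt_symm p |>.continuousOn
  let U := e.target ∩ g ⁻¹' {0}ᶜ
  have hU : IsOpen U :=
    hg.isOpen_inter_preimage (isOpen_extChartAt_target p) isOpen_compl_singleton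
  have hUt : U ⊆ e.target := inter_subset_left
  have hgp : pseudoFormL n s ((F.normalPosition ∘ e.symm) (e p))
      ((F.normalPosition ∘ e.symm) (e p)) ≠ 0 := by
    rwa [Function.comp_apply, hep]
  have hx : e p ∈ U := ⟨mem_extChartAt_target p, hgp⟩
  -- The constant is `1 + ρ` because `R = φ + ρ = μ + (1 + ρ)` with `μ = φ - 1`.
  have key := rigidity_of_yamabe (n := n) (s := s) (Φ := F.localRep p)
    (ξ := F.normalPosition ∘ e.symm) (μ := fun y => φ (e.symm y) - 1) hn hU
    (hΦ.mono hUt) (hξ.mono hUt) ((hφ.mono hUt).sub contDiffOn_const)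
    (fun y hy => F.pseudoFormL_normalPosition_coordDeriv (hUt hy))
    (fun y _ => F.pseudoFormL_normalPosition_self _)
    (fun y hy => F.det_gramMatrix_localRep_ne_zero (hUt hy))
    (fun y hy i j => by
      rw [gramMatrix_apply, coordDeriv, coordDeriv, coordDeriv, localRep,
        fderiv_comp_extChartAt_symm (hUt hy) (hξd _), fderiv_comp_extChartAt_symm (hUt hy) (hPd _)]
      exact hS.vectorDeriv_normalPosition _ _ _)
    (1 + ρ)
    (fun y hy => by
      have h := IsYamabeSoliton.scalarCurvature_mul ⟨hS, ρ, hρ⟩ (e.symm y) hy.2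
      rw [show F.scalarCurvature (e.symm y) = φ (e.symm y) - 1 + (1 + ρ) by rw [hρ]; ring] at h
      rw [← pow_two]
      exact h) hx hgp
  refine ⟨?_, ?_, ?_⟩
  · ext1 a
    rw [vectorDeriv_eq_fderiv_comp_extChartAt_symm (hξd p),
      vectorDeriv_eq_fderiv_comp_extChartAt_symm (hPd p), neg_apply, smul_apply,
      fderiv_apply_eq_sum_coordDeriv, fderiv_apply_eq_sum_coordDeriv, Finset.smul_sum,
      ← Finset.sum_neg_distrib]
    refine Finset.sum_congr rfl fun i _ => ?_
    rw [← he, (key i).1, hep, smul_neg, smul_comm]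
    rfl
  · ext1 a
    rw [vectorDeriv_eq_fderiv_comp_extChartAt_symm hφd, fderiv_apply_eq_sum_coordDeriv]
    refine Finset.sum_eq_zero fun i _ => ?_
    have h := (key i).2.1
    rw [partialDeriv, fderiv_sub_const] at h
    exact (congrArg _ h).trans (smul_zero _)
  · rw [or_iff_not_imp_left]
    intro h1 a
    rw [vectorDeriv_eq_fderiv_comp_extChartAt_symm (hPd p)]
    refine pseudoFormL_fderiv_eq_zero (fun i => ?_) a
    have h := (key i).2.2.resolve_left (by rw [hep]; exact sub_ne_zero.2 h1)
    rwa [localRep, Function.comp_apply, ← he, hep] at h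

/-- Where `f ≠ 0`, `dξ` is tangential by rigidity, so `df = 2⟨ξ, dξ⟩ = 0`. The level set of a
nonzero value is therefore open as well as closed. -/
theorem IsYamabeSoliton.normalPosition_self_const [PreconnectedSpace M] (hn : 2 ≤ n)
    (hF : F.IsYamabeSoliton F.tangentialPosition φ) {p : M}
    (hf : pseudoFormL n s (F.normalPosition p) (F.normalPosition p) ≠ 0) (q : M) :
    pseudoFormL n s (F.normalPosition q) (F.normalPosition q) =
      pseudoFormL n s (F.normalPosition p) (F.normalPosition p) := by
  have hξM := F.contMDiff_normalPosition hF.1.smooth_vectorField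
  have hsm := contMDiff_pseudoFormL_self (s := s) hξM
  have hcl : IsClopen {q | pseudoFormL n s (F.normalPosition q) (F.normalPosition q) =
      pseudoFormL n s (F.normalPosition p) (F.normalPosition p)} := by
    refine ⟨isClosed_eq hsm.continuous continuous_const, isOpen_iff_mem_nhds.2 fun q hq => ?_⟩
    have hne := (hsm.continuous.continuousAt (x := q)).eventually_ne
      (ne_of_eq_of_ne hq hf)
    have h0 : ∀ᶠ r in nhds q, vectorDeriv n
        (fun q => pseudoFormL n s (F.normalPosition q) (F.normalPosition q)) r = 0 := by
      filter_upwards [hne] with r hr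
      ext1 a
      rw [vectorDeriv_pseudoFormL_self hξM r a, (hF.rigidity hn r hr).1, neg_apply, smul_apply,
        map_neg, map_smul, F.pseudoFormL_normalPosition_vectorDeriv, smul_zero, neg_zero, mul_zero,
        zero_apply]
    filter_upwards [eventually_eq_of_vectorDeriv_eq_zero (hsm.mdifferentiable (by simp)) h0]
      with r hr using hr.trans hq
  exact (hcl.eq_univ ⟨p, rfl⟩).ge (mem_univ q)

end Soliton

/-- The hypersurface itself serves as the cone: its complete integral curves, reparametrized by the
logarithm, cover the rays `t • V` for all `t > 0`. -/
theorem isConicHypersurface_range {n s : ℕ} {M : Type u} [TopologicalSpace M] [T2Space M]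
    [SecondCountableTopology M] [ConnectedSpace M] [ChartedSpace (EuclideanSpace ℝ (Fin n)) M]
    [IsManifold (𝓡 n) ∞ M] {F : PseudoRiemannianHypersurface n s M}
    (hc : IsCompleteVectorField F.tangentialPosition) (hξ : ∀ q, F.normalPosition q = 0) :
    IsConicHypersurface.{u} n (range F.position) := by
  refine ⟨M, inferInstance, inferInstance, F.position, inferInstance, inferInstance,
    inferInstance, inferInstance, F.contMDiff_position, F.injective_vectorDeriv_position,
    fun q => ?_, rfl⟩
  obtain ⟨γ, h0, hγ⟩ := hc q
  have hcont : Continuous γ := continuous_iff_continuousAt.2 fun t => (hγ t).continuousAt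
  refine ⟨γ ∘ Real.log, hcont.comp_continuousOn
    (Real.continuousOn_log.mono fun t ht => ne_of_gt ht), by simp [h0], fun t ht => ?_⟩
  rw [Function.comp_apply, position_integralCurve hξ hγ, Real.exp_log ht, h0]

end PseudoRiemannianHypersurface

/-! ### Conclusion: the four cases -/

theorem isHyperplane_mk'_ker {n : ℕ} {l : Module.Dual ℝ (AmbientSpace n)} (hl : l ≠ 0)
    (x : AmbientSpace n) :
    IsHyperplane n (AffineSubspace.mk' x (LinearMap.ker l)) := by
  refine ⟨_, AffineSubspace.mk'_nonempty _ _, ?_, rfl⟩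
  have h := Module.Dual.finrank_ker_add_one_of_ne_zero hl
  rw [AffineSubspace.direction_mk']
  simpa using h

theorem mainTheorem2 (n s : ℕ) (hn : 2 ≤ n) (hs : s ≤ n + 1)
    (M : Type u) [TopologicalSpace M] [T2Space M] [SecondCountableTopology M] [ConnectedSpace M]
    [ChartedSpace (EuclideanSpace ℝ (Fin n)) M] [IsManifold (𝓡 n) ∞ M]
    (F : PseudoRiemannianHypersurface n s M) (φ : M → ℝ)
    (hF : F.IsYamabeSoliton F.tangentialPosition φ) :
    (∃ S : Set (AmbientSpace n), IsHyperplane n S ∧ range F.position ⊆ S) ∨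
    (∃ S : Set (AmbientSpace n), IsConicHypersurface.{u} n S ∧ range F.position ⊆ S) ∨
    (∃ c : ℝ, 0 < c ∧ range F.position ⊆ pseudoHyperbolicSpace n s c) ∨
    (∃ c : ℝ, 0 < c ∧ range F.position ⊆ pseudoSphere n s c) := by
  set f : M → ℝ := fun q => pseudoFormL n s (F.normalPosition q) (F.normalPosition q) with hf
  by_cases h0 : ∀ q, f q = 0
  · exact Or.inr (Or.inl ⟨_, PseudoRiemannianHypersurface.isConicHypersurface_range hF.1.complete
      fun q => F.normalPosition_eq_zero_of_null q (h0 q), Subset.rfl⟩)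
  push Not at h0
  obtain ⟨p, hp⟩ := h0
  have hconst : ∀ q, f q = f p := hF.normalPosition_self_const hn hp
  have hrig := fun q => hF.rigidity hn q (ne_of_eq_of_ne (hconst q) hp)
  have hφ : ∀ q, φ q = φ p := fun q => eq_of_forall_vectorDeriv_eq_zero
    (hF.1.smooth_function.mdifferentiable (by simp)) (fun q => (hrig q).2.1) q p
  by_cases h1 : φ p = 1
  · left
    have hξ : ∀ q, F.normalPosition q = F.normalPosition p := fun q =>
      eq_of_forall_vectorDeriv_eq_zero
        ((F.contMDiff_normalPosition hF.1.smooth_vectorField).mdifferentiable (by simp))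
        (fun q => by rw [(hrig q).1, hφ, h1, sub_self, zero_smul, neg_zero]) q p
    refine ⟨_, isHyperplane_mk'_ker (l := (pseudoFormL n s (F.normalPosition p)).toLinearMap)
      (fun h => hp (DFunLike.congr_fun h (F.normalPosition p))) (F.position p), ?_⟩
    rintro _ ⟨q, rfl⟩
    rw [SetLike.mem_coe, AffineSubspace.mem_mk', LinearMap.mem_ker, vsub_eq_sub, map_sub,
      sub_eq_zero]
    -- With `ξ` constant, `⟨ξ, V⟩ = ⟨ξ, ξ⟩` takes the same value at `q` and at `p`.
    have h2 := F.pseudoFormL_normalPosition_self q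
    rw [hξ q] at h2
    exact h2.symm.trans (F.pseudoFormL_normalPosition_self p)
  · right; right
    have hF0 : ∀ q a, pseudoFormL n s (F.position q)
        (vectorDeriv n F.position q a) = 0 := fun q =>
      (hrig q).2.2.resolve_left (by rwa [hφ])
    -- Since `V` is orthogonal to the tangent vector `V - ξ`, `⟨V, V⟩ = ⟨V, ξ⟩ = ⟨ξ, ξ⟩`.
    have hval : ∀ q, pseudoForm n s (F.position q) (F.position q) = f p := by
      intro q
      rw [← hconst q, hf, ← pseudoFormL_apply]
      simp only
      rw [F.pseudoFormL_normalPosition_self q, pseudoFormL_comm n s (F.normalPosition q),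
        ← sub_eq_zero, ← map_sub, sub_eq_of_eq_add (F.position_eq_add_normalPosition q), hF0]
    rcases lt_or_gt_of_ne hp with h | h
    · left
      -- This `c` solves `-c⁻² = f p`.
      refine ⟨(√(-f p))⁻¹, inv_pos.2 (Real.sqrt_pos.2 (by linarith)), ?_⟩
      rintro _ ⟨q, rfl⟩
      rw [pseudoHyperbolicSpace, mem_ofPred_eq, hval, inv_pow, inv_inv, Real.sq_sqrt (by linarith),
        neg_neg]
    · right
      refine ⟨(√(f p))⁻¹, inv_pos.2 (Real.sqrt_pos.2 h), ?_⟩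
      rintro _ ⟨q, rfl⟩
      rw [pseudoSphere, mem_ofPred_eq, hval, inv_pow, inv_inv, Real.sq_sqrt h.le]
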